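/- Let $k$ be a positive integer, $1\le i<j\le k$, and let $\lambda=(\lambda_1,\dots,\lambda_k)\in\mathbb R^k$, regarded as the weight $\sum_a\lambda_a\epsilon_a$ of $\mathfrak{sl}(k,\mathbb R)$, where $\epsilon_a(H)=h_{aa}$ for a trace-free diagonal matrix $H=(h_{ab})$. Such a weight is called dominant integral if $\lambda_a-\lambda_b\in\{0,1,2,\dots\}$ for all $a<b$. Let $\lambda_{(ij)}$ be obtained from $\lambda$ by adding $1$ to the $i$-th and to the $j$-th entry, and assume that both $\lambda$ and $\lambda_{(ij)}$ are dominant integral. For a dominant integral weight $\mu$ let $V_\mu$ denote the irreducible finite-dimensional complex representation of $\mathfrak{sl}(k,\mathbb R)$ with highest weight $\mu$ (with respect to the diagonal Cartan subalgebra and the upper triangular positive root vectors), and let $V=\mathbb C^k$ be the complexified defining representation. Then $V_{\lambda_{(ij)}}$ occurs with multiplicity exactly one in $\Lambda^2V\otimes V_\lambda$ (exterior and tensor products over $\mathbb C$). That is, $\Lambda^2V\otimes V_\lambda=N\oplus C$ with subrepresentations $N\cong V_{\lambda_{(ij)}}$ and $C$, where $C$ contains no subrepresentation isomorphic to $V_{\lambda_{(ij)}}$.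 The same holds for representations of $\mathfrak{gl}(k,\mathbb R)$, when each $V_\mu$ is extended to $\mathfrak{gl}(k,\mathbb R)$ by letting the identity matrix act as the scalar $\sum_a\mu_a$ and $V=\mathbb C^k$ is the defining representation of $\mathfrak{gl}(k,\mathbb R)$. -/

import Mathlib

open scoped TensorProduct

attribute [local instance 100] LieRing.ofAssociativeRing

noncomputable section

namespace GLRep

/-- A complex representation, on `W`, of a real Lie algebra `L`: a homomorphism of real Lie
algebras from `L` to the complex-linear endomorphisms of `W`. -/
abbrev CRep (L : Type*) [LieRing L] [LieAlgebra ℝ L] (W : Type*) [AddCommGroup W] [Module ℂ W] :=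
  L →ₗ⁅ℝ⁆ Module.End ℂ W

section General

variable {L : Type*} [LieRing L] [LieAlgebra ℝ L]
  {W : Type*} [AddCommGroup W] [Module ℂ W]
  {U : Type*} [AddCommGroup U] [Module ℂ U]

/-- A complex subspace that is stable under the action. -/
def IsInvariant (ρ : CRep L W) (p : Submodule ℂ W) : Prop :=
  ∀ x : L, ∀ w ∈ p, ρ x w ∈ p

/-- Irreducibility: nonzero, and no invariant complex subspace besides `0` and the whole space. -/
def IsIrreducible (ρ : CRep L W) : Prop :=
  Nontrivial W ∧ ∀ p : Submodule ℂ W, IsInvariant ρ p → p = ⊥ ∨ p = ⊤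

/-- A complex-linear map that commutes with the actions. -/
def Intertwines (σ : CRep L U) (τ : CRep L W) (f : U →ₗ[ℂ] W) : Prop :=
  ∀ (x : L) (u : U), f (σ x u) = τ x (f u)

/-- The direct sum of `m` copies of a representation. -/
def copies (σ : CRep L U) (m : ℕ) : CRep L (Fin m → U) where
  toFun x := LinearMap.pi fun a => σ x ∘ₗ LinearMap.proj a
  map_add' x y := by ext; simp
  map_smul' c x := by ext; simp
  map_lie' := by
    intro x y
    ext
    simp [LieRing.of_associative_ring_bracket]

/-- The irreducible representation `σ` occurs in `τ` with multiplicity exactly `m`: the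
representation `τ` is the direct sum of a subrepresentation isomorphic to `σ ⊕ ⋯ ⊕ σ`
(`m` summands) and a subrepresentation `C` that contains no copy of `σ`. -/
def HasMultiplicity (σ : CRep L U) (τ : CRep L W) (m : ℕ) : Prop :=
  ∃ (e : (Fin m → U) →ₗ[ℂ] W) (C : Submodule ℂ W),
    Intertwines (copies σ m) τ e ∧ Function.Injective e ∧
    IsInvariant τ C ∧ IsCompl (LinearMap.range e) C ∧
    ¬ ∃ f : U →ₗ[ℂ] W, Intertwines σ τ f ∧ Function.Injective f ∧ LinearMap.range f ≤ C

/-- The tensor product of two representations, `x(u ⊗ w) = xu ⊗ w + u ⊗ xw`. -/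
def tensorRep (σ : CRep L U) (τ : CRep L W) : CRep L (U ⊗[ℂ] W) where
  toFun x := TensorProduct.map (σ x) LinearMap.id + TensorProduct.map LinearMap.id (τ x)
  map_add' x y := by
    apply TensorProduct.ext'
    intro u w
    simp [TensorProduct.add_tmul, TensorProduct.tmul_add]
    abel
  map_smul' c x := by
    apply TensorProduct.ext'
    intro u w
    simp [TensorProduct.smul_tmul', ← Complex.coe_smul]
  map_lie' := by
    intro x y
    apply TensorProduct.ext'
    intro u w
    simp [LieRing.of_associative_ring_bracket, TensorProduct.sub_tmul, TensorProduct.tmul_sub]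
    abel

lemma update_pair_zero {α : Type*} (x y z : α) : Function.update ![x, z] 0 y = ![y, z] := by
  funext a
  fin_cases a <;> rfl

lemma update_pair_one {α : Type*} (x y z : α) : Function.update ![x, z] 1 y = ![x, y] := by
  funext a
  fin_cases a <;> rfl

lemma wedge_add_left (x y z : W) : exteriorPower.ιMulti ℂ 2 ![x + y, z] =
    exteriorPower.ιMulti ℂ 2 ![x, z] + exteriorPower.ιMulti ℂ 2 ![y, z] := by
  have h := (exteriorPower.ιMulti ℂ 2 (M := W)).map_update_add ![x, z] 0 x y
  simpa only [update_pair_zero] using h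

lemma wedge_add_right (x y z : W) : exteriorPower.ιMulti ℂ 2 ![z, x + y] =
    exteriorPower.ιMulti ℂ 2 ![z, x] + exteriorPower.ιMulti ℂ 2 ![z, y] := by
  have h := (exteriorPower.ιMulti ℂ 2 (M := W)).map_update_add ![z, x] 1 x y
  simpa only [update_pair_one] using h

lemma wedge_smul_left (c : ℂ) (x z : W) : exteriorPower.ιMulti ℂ 2 ![c • x, z] =
    c • exteriorPower.ιMulti ℂ 2 ![x, z] := by
  have h := (exteriorPower.ιMulti ℂ 2 (M := W)).map_update_smul ![x, z] 0 c x
  simpa only [update_pair_zero] using h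

lemma wedge_smul_right (c : ℂ) (x z : W) : exteriorPower.ιMulti ℂ 2 ![z, c • x] =
    c • exteriorPower.ιMulti ℂ 2 ![z, x] := by
  have h := (exteriorPower.ιMulti ℂ 2 (M := W)).map_update_smul ![z, x] 1 c x
  simpa only [update_pair_one] using h

lemma wedge_self (x : W) : exteriorPower.ιMulti ℂ 2 ![x, x] = 0 :=
  (exteriorPower.ιMulti ℂ 2 (M := W)).map_eq_zero_of_eq ![x, x] (i := 0) (j := 1) rfl (by decide)

lemma wedge_swap_add (x y : W) : exteriorPower.ιMulti ℂ 2 ![x, y] +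
    exteriorPower.ιMulti ℂ 2 ![y, x] = 0 := by
  have h := wedge_self (x + y)
  rw [wedge_add_left, wedge_add_right, wedge_add_right, wedge_self, wedge_self] at h
  simpa using h

/-- The alternating map `(u, v) ↦ fu ∧ v + u ∧ fv`. -/
def wedgeDerivAlt (f : Module.End ℂ W) : W [⋀^Fin 2]→ₗ[ℂ] (⋀[ℂ]^2 W) where
  toFun v := exteriorPower.ιMulti ℂ 2 ![f (v 0), v 1] + exteriorPower.ιMulti ℂ 2 ![v 0, f (v 1)]
  map_update_add' := by
    intro inst v i x y
    rw [Subsingleton.elim inst (instDecidableEqFin 2)]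
    fin_cases i <;> simp [wedge_add_left, wedge_add_right] <;> abel
  map_update_smul' := by
    intro inst v i c x
    rw [Subsingleton.elim inst (instDecidableEqFin 2)]
    fin_cases i <;> simp [wedge_smul_left, wedge_smul_right]
  map_eq_zero_of_eq' := by
    intro v i j h hij
    have h01 : v 0 = v 1 := by
      fin_cases i <;> fin_cases j <;> simp_all
    rw [h01]
    exact wedge_swap_add _ _

/-- The endomorphism `u ∧ v ↦ fu ∧ v + u ∧ fv` of the second exterior power. -/
def wedgeDeriv (f : Module.End ℂ W) : Module.End ℂ (⋀[ℂ]^2 W) :=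
  exteriorPower.alternatingMapLinearEquiv (wedgeDerivAlt f)

lemma wedgeDeriv_wedge (f : Module.End ℂ W) (u v : W) :
    wedgeDeriv f (exteriorPower.ιMulti ℂ 2 ![u, v]) =
      exteriorPower.ιMulti ℂ 2 ![f u, v] + exteriorPower.ιMulti ℂ 2 ![u, f v] := by
  rw [wedgeDeriv, exteriorPower.alternatingMapLinearEquiv_apply_ιMulti]
  rfl

lemma end_extSquare_ext {f g : Module.End ℂ (⋀[ℂ]^2 W)}
    (h : ∀ u v : W, f (exteriorPower.ιMulti ℂ 2 ![u, v]) = g (exteriorPower.ιMulti ℂ 2 ![u, v])) :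
    f = g := by
  apply exteriorPower.linearMap_ext
  ext1 v
  have hv : v = ![v 0, v 1] := by
    funext a
    fin_cases a <;> rfl
  have h2 := h (v 0) (v 1)
  rw [← hv] at h2
  exact h2

/-- The second exterior power of a representation, `x(u ∧ v) = xu ∧ v + u ∧ xv`. -/
def extSquare (ρ : CRep L W) : CRep L (⋀[ℂ]^2 W) where
  toFun x := wedgeDeriv (ρ x)
  map_add' x y := by
    apply end_extSquare_ext
    intro u v
    simp only [wedgeDeriv_wedge, map_add, LinearMap.add_apply, wedge_add_left, wedge_add_right]
    abel
  map_smul' c x := by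
    apply end_extSquare_ext
    intro u v
    simp only [wedgeDeriv_wedge, map_smul, LinearMap.smul_apply, RingHom.id_apply,
      ← Complex.coe_smul, wedge_smul_left, wedge_smul_right, smul_add]
  map_lie' := by
    intro x y
    apply end_extSquare_ext
    intro u v
    have hl (a b c : W) : exteriorPower.ιMulti ℂ 2 ![a - b, c] =
        exteriorPower.ιMulti ℂ 2 ![a, c] - exteriorPower.ιMulti ℂ 2 ![b, c] := by
      rw [eq_sub_iff_add_eq, ← wedge_add_left, sub_add_cancel]
    have hr (a b c : W) : exteriorPower.ιMulti ℂ 2 ![c, a - b] =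
        exteriorPower.ιMulti ℂ 2 ![c, a] - exteriorPower.ιMulti ℂ 2 ![c, b] := by
      rw [eq_sub_iff_add_eq, ← wedge_add_right, sub_add_cancel]
    rw [LieRing.of_associative_ring_bracket, LinearMap.sub_apply, Module.End.mul_apply,
      Module.End.mul_apply, LieHom.map_lie, LieRing.of_associative_ring_bracket]
    simp only [wedgeDeriv_wedge, LinearMap.sub_apply, Module.End.mul_apply, map_add, hl, hr]
    abel

end General

/-- The Lie algebra `𝔤𝔩(k, ℝ)`. -/
abbrev gl (k : ℕ) := Matrix (Fin k) (Fin k) ℝ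

/-- The Lie algebra `𝔰𝔩(k, ℝ)` of trace-free matrices. -/
abbrev sl (k : ℕ) := LieAlgebra.SpecialLinear.sl (Fin k) ℝ

/-- The (complexified) defining representation of `𝔤𝔩(k, ℝ)`: matrices acting on `ℂᵏ`. -/
def defGL (k : ℕ) : CRep (gl k) (Fin k → ℂ) :=
  AlgHom.toLieHom
    (((Matrix.toLinAlgEquiv' : Matrix (Fin k) (Fin k) ℂ ≃ₐ[ℂ] _).toAlgHom.restrictScalars ℝ).comp
      (Algebra.ofId ℝ ℂ).mapMatrix)

/-- The (complexified) defining representation of `𝔰𝔩(k, ℝ)`. -/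
def defSL (k : ℕ) : CRep (sl k) (Fin k → ℂ) :=
  (defGL k).comp (sl k).incl

variable {k : ℕ}

/-- The weight `∑ λₐ εₐ` is dominant integral: `λₐ - λ_b` is a natural number for `a < b`. -/
def IsDominantIntegral (lam : Fin k → ℝ) : Prop :=
  ∀ a b : Fin k, a < b → ∃ n : ℕ, lam a - lam b = n

/-- The weight obtained by adding `1` to the `i`-th and to the `j`-th entry. -/
def addPair (lam : Fin k → ℝ) (i j : Fin k) : Fin k → ℝ :=
  lam + Pi.single i 1 + Pi.single j 1

/-- There is a nonzero vector on which the trace-free diagonal matrices act through the weight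
`∑ λₐ εₐ` and which the strictly upper triangular matrices annihilate. -/
def HasHighestWeight {W : Type*} [AddCommGroup W] [Module ℂ W]
    (ρ : CRep (sl k) W) (lam : Fin k → ℝ) : Prop :=
  ∃ v : W, v ≠ 0 ∧
    (∀ h : sl k, h.1.IsDiag → ρ h v = ((∑ a, lam a * h.1 a a : ℝ) : ℂ) • v) ∧
    (∀ n : sl k, (∀ a b : Fin k, b ≤ a → n.1 a b = 0) → ρ n v = 0)

/-- The trace-free part `x - (tr x / k) 1` of a matrix. -/
def traceFree (k : ℕ) : gl k →ₗ⁅ℝ⁆ sl k where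
  toFun x := ⟨x - (x.trace / k) • (1 : gl k), by
    change Matrix.trace (x - (x.trace / k) • (1 : gl k)) = 0
    rcases Nat.eq_zero_or_pos k with rfl | hk
    · simp [Matrix.trace]
    · have : (k : ℝ) ≠ 0 := by positivity
      simp [Matrix.trace_sub, Matrix.trace_smul, this]⟩
  map_add' x y := by
    apply Subtype.ext
    simp [Matrix.trace_add, add_div, add_smul]
    abel
  map_smul' c x := by
    apply Subtype.ext
    simp [Matrix.trace_smul, mul_div_assoc, smul_sub, mul_smul]
  map_lie' := by
    intro x y
    apply Subtype.ext
    simp [LieRing.of_associative_ring_bracket, Matrix.trace_sub, Matrix.trace_mul_comm x y,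
      sub_mul, mul_sub, smul_sub, smul_comm (Matrix.trace x / (k : ℝ))]
    abel

/-- The extension of a representation of `𝔰𝔩(k, ℝ)` to `𝔤𝔩(k, ℝ)` for which the identity matrix
acts as the scalar `c`. -/
def extendGL {W : Type*} [AddCommGroup W] [Module ℂ W]
    (ρ : CRep (sl k) W) (c : ℝ) : CRep (gl k) W where
  toFun x := ρ (traceFree k x) + (x.trace / k * c) • (1 : Module.End ℂ W)
  map_add' x y := by
    rw [map_add, map_add, Matrix.trace_add]
    module
  map_smul' a x := by
    rw [map_smul, map_smul, Matrix.trace_smul, RingHom.id_apply, smul_eq_mul]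
    module
  map_lie' := by
    intro x y
    rw [LieHom.map_lie, LieHom.map_lie, LieAlgebra.matrix_trace_commutator_zero]
    simp [LieRing.of_associative_ring_bracket, add_mul, mul_add]
    module

end GLRep

end

/-! Work over `gl`, where weights are vectors rather than classes modulo the trace, and descend to
`sl` at the end. Three points carry the proof. (1) Unitarity. Polynomials in the entries of a `k ×
k` matrix, twisted by a real multiple of the trace, carry the Fischer inner product, for which a
real matrix has its transpose as adjoint (`isContravariant_fischer`). Products of leading minors are
highest weight vectors realising every dominant integral weight, up to the twist
(`IsDominantIntegral.exists_poly`). A graph argument (`IsContravariant.exists_embedding`) embeds an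
irreducible highest weight representation in any such space that has a highest weight vector of the
same weight. Hence `V_λ`, and then `Λ²V ⊗ V_λ`, has a contravariant inner product, and
finite-dimensional invariant subspaces have invariant complements. (2) Uniqueness. Pair a highest
weight vector `t` of weight `λ + εᵢ + εⱼ` in `Λ²V ⊗ V_λ`, through its Plücker components, with
`V_λ`. By weights, the highest weight vector `w` of `V_λ` pairs nontrivially only with the component
along `eᵢ ∧ eⱼ`. Lowering spreads the vanishing of this one number to all of `V_λ`, so it determines
`t` (`IsContravariant.eq_zero_of_component`). (3) Existence. Let `ω_n` be the sum of the first `n`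
coordinates `ε_a`, with indices counted from zero. The polarised minors give highest weight vectors
of weight `ω_i + εᵢ` in `V ⊗` polynomials. Wedging those for `i` and `j`, and multiplying by a
highest weight polynomial for the remaining weight, gives the required vector when `j > i + 1`. For
adjacent indices `λ - ω_i - ω_j` need not be dominant, and a minor with two free columns is used
instead (`exists_coefficients`). Projecting the coefficients onto `V_λ` keeps the component along
`eᵢ ∧ eⱼ` a nonzero multiple of `w`. -/

namespace GLRep

/-! ### Highest weight vectors and lowering operators. -/

section HighestWeight

variable {k : ℕ} {M : Type*} [AddCommGroup M] [Module ℂ M] {N : Type*} [AddCommGroup N] [Module ℂ N]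

/-- A vector on which diagonal matrices act through the weight `μ` and which is annihilated by the
strictly upper triangular matrices. -/
structure IsHighestWeightVector (R : CRep (gl k) M) (μ : Fin k → ℝ) (v : M) : Prop where
  diag : ∀ h : gl k, h.IsDiag → R h v = ((∑ a, μ a * h a a : ℝ) : ℂ) • v
  upper : ∀ n : gl k, (∀ a b : Fin k, b ≤ a → n a b = 0) → R n v = 0

/-- A subspace stable under the strictly lower triangular matrix units. -/
def LowerStable (R : CRep (gl k) M) (p : Submodule ℂ M) : Prop :=
  ∀ a b : Fin k, a < b → ∀ v ∈ p, R (Matrix.single b a 1) v ∈ p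

lemma LowerStable.apply_mem {R : CRep (gl k) M} {p : Submodule ℂ M} (hp : LowerStable R p)
    {x : gl k} (hx : ∀ a b : Fin k, a ≤ b → x a b = 0) {v : M} (hv : v ∈ p) : R x v ∈ p := by
  rw [Matrix.matrix_eq_sum_single x]
  simp only [map_sum, LinearMap.sum_apply]
  refine sum_mem fun b _ => sum_mem fun a _ => ?_
  rcases le_or_gt b a with hba | hab
  · rw [hx b a hba, Matrix.single_zero, map_zero]
    exact zero_mem _
  · have h1 : Matrix.single b a (x b a) = x b a • Matrix.single b a (1 : ℝ) := by
      rw [Matrix.smul_single, smul_eq_mul, mul_one]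
    rw [h1, map_smul, LinearMap.smul_apply, ← Complex.coe_smul]
    exact p.smul_mem _ (hp a b hab v hv)

/-- The smallest subspace containing `v` and stable under strictly lower triangular matrices. -/
def lowerSpan (R : CRep (gl k) M) (v : M) : Submodule ℂ M :=
  sInf {p | v ∈ p ∧ LowerStable R p}

lemma mem_lowerSpan_self (R : CRep (gl k) M) (v : M) : v ∈ lowerSpan R v :=
  Submodule.mem_sInf.2 fun _ hp => hp.1

lemma lowerSpan_le {R : CRep (gl k) M} {v : M} {p : Submodule ℂ M} (hv : v ∈ p)
    (hp : LowerStable R p) : lowerSpan R v ≤ p :=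
  sInf_le ⟨hv, hp⟩

lemma lowerStable_lowerSpan (R : CRep (gl k) M) (v : M) : LowerStable R (lowerSpan R v) :=
  fun a b hab w hw => Submodule.mem_sInf.2 fun p hp =>
    hp.2 a b hab w (Submodule.mem_sInf.1 hw p hp)

lemma apply_apply_eq (R : CRep (gl k) M) (x y : gl k) (v : M) :
    R x (R y v) = R y (R x v) + R ⁅x, y⁆ v := by
  rw [LieHom.map_lie, LieRing.of_associative_ring_bracket]
  simp

/-- The vectors of the span that every matrix keeps inside it contain `v`, by splitting a matrix
into lower, diagonal and upper parts. They are lower stable by `x E w = E x w + [x, E] w`, so they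
exhaust the span. -/
lemma IsHighestWeightVector.isInvariant_lowerSpan {R : CRep (gl k) M} {μ : Fin k → ℝ} {v : M}
    (hv : IsHighestWeightVector R μ v) : IsInvariant R (lowerSpan R v) := by
  have key : lowerSpan R v ≤
      { carrier := {w | w ∈ lowerSpan R v ∧ ∀ x : gl k, R x w ∈ lowerSpan R v}
        add_mem' := fun ha hb => ⟨add_mem ha.1 hb.1, fun x => by
          rw [map_add]; exact add_mem (ha.2 x) (hb.2 x)⟩
        zero_mem' := ⟨zero_mem _, fun x => by rw [map_zero]; exact zero_mem _⟩
        smul_mem' := fun c w hw => ⟨Submodule.smul_mem _ _ hw.1, fun x => by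
          rw [map_smul]; exact Submodule.smul_mem _ _ (hw.2 x)⟩ } := by
    refine lowerSpan_le ⟨mem_lowerSpan_self R v, fun x => ?_⟩ ?_
    · let l : gl k := Matrix.of fun a b => if b < a then x a b else 0
      let d : gl k := Matrix.diagonal fun a => x a a
      let n : gl k := Matrix.of fun a b => if a < b then x a b else 0
      have hx : x = l + d + n := by
        ext a b
        rcases lt_trichotomy a b with h | h | h
        · simp [l, d, n, h, h.not_gt, h.ne]
        · simp [l, d, n, h]
        · simp [l, d, n, h, h.not_gt, h.ne']
      rw [hx, map_add, map_add, LinearMap.add_apply, LinearMap.add_apply,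
        hv.diag d (Matrix.isDiag_diagonal _),
        hv.upper n (fun a b hab => by simp [n, hab.not_gt]), add_zero]
      exact add_mem ((lowerStable_lowerSpan R v).apply_mem
        (fun a b hab => by simp [l, hab.not_gt]) (mem_lowerSpan_self R v))
        (Submodule.smul_mem _ _ (mem_lowerSpan_self R v))
    · rintro a b hab w ⟨hw, hw'⟩
      refine ⟨lowerStable_lowerSpan R v a b hab w hw, fun x => ?_⟩
      rw [apply_apply_eq]
      exact add_mem (lowerStable_lowerSpan R v a b hab _ (hw' x)) (hw' _)
  exact fun x w hw => (key hw).2 x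

/-- An induction principle: a linear condition on an irreducible representation need only be checked
on the highest weight vector and under lowering. -/
lemma IsHighestWeightVector.eq_top {R : CRep (gl k) M} (hR : IsIrreducible R) {μ : Fin k → ℝ}
    {v : M} (hv : IsHighestWeightVector R μ v) (hv0 : v ≠ 0) {p : Submodule ℂ M} (hvp : v ∈ p)
    (hp : LowerStable R p) : p = ⊤ := by
  rcases hR.2 _ hv.isInvariant_lowerSpan with h | h
  · have := mem_lowerSpan_self R v
    rw [h] at this
    exact absurd ((Submodule.mem_bot ℂ).1 this) hv0
  · exact top_le_iff.1 (h ▸ lowerSpan_le hvp hp)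

/-- The diagonal matrix with strictly decreasing entries `0, -1, -2, …`. -/
noncomputable def descending (k : ℕ) : gl k := Matrix.diagonal fun a => -((a : ℕ) : ℝ)

/-- The sum of the eigenspaces of `descending k` for the eigenvalues `c - 1, c - 2, …`. -/
noncomputable def below (R : CRep (gl k) M) (c : ℂ) : Submodule ℂ M :=
  ⨆ n : ℕ, Module.End.eigenspace (R (descending k)) (c - (n + 1 : ℕ))

/-- The eigenvalue drops by `b - a ≥ 1`; the form `b - a - 1 + 1` matches the successors indexing
`below`. -/
lemma lower_mem_eigenspace (R : CRep (gl k) M) {a b : Fin k} (hab : a < b) {c : ℂ} {v : M}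
    (hv : v ∈ Module.End.eigenspace (R (descending k)) c) :
    R (Matrix.single b a 1) v ∈
      Module.End.eigenspace (R (descending k)) (c - ((b : ℕ) - (a : ℕ) - 1 + 1 : ℕ)) := by
  rw [Module.End.mem_eigenspace_iff] at hv ⊢
  have h1 : ⁅descending k, Matrix.single b a (1 : ℝ)⁆ =
      (-(((b : ℕ) - (a : ℕ) - 1 + 1 : ℕ) : ℝ)) • Matrix.single b a (1 : ℝ) := by
    rw [Nat.sub_add_cancel (Nat.sub_pos_of_lt hab), Nat.cast_sub (Fin.lt_def.1 hab).le,
      LieRing.of_associative_ring_bracket]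
    ext r s
    simp only [descending, Matrix.sub_apply, Matrix.diagonal_mul, Matrix.mul_diagonal,
      Matrix.smul_apply, Matrix.single_apply, smul_eq_mul]
    split_ifs with h
    · rw [← h.1, ← h.2]; ring
    · ring
  rw [apply_apply_eq, hv, h1, map_smul, map_smul, LinearMap.smul_apply, ← Complex.coe_smul,
    ← add_smul]
  congr 1
  push_cast
  ring

lemma eigenspace_lower_le_below (R : CRep (gl k) M) {a b : Fin k} (hab : a < b) {c : ℂ} {v : M}
    (hv : v ∈ Module.End.eigenspace (R (descending k)) c) :
    R (Matrix.single b a 1) v ∈ below R c :=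
  Submodule.mem_iSup_of_mem _ (lower_mem_eigenspace R hab hv)

lemma lowerStable_below (R : CRep (gl k) M) (c : ℂ) : LowerStable R (below R c) := by
  intro a b hab v hv
  have : below R c ≤ (below R c).comap (R (Matrix.single b a 1)) := by
    refine iSup_le fun n w hw => ?_
    refine Submodule.mem_iSup_of_mem (n + ((b : ℕ) - (a : ℕ) - 1 + 1)) ?_
    have := lower_mem_eigenspace R hab hw
    convert this using 2
    push_cast
    ring
  exact this hv

/-- Eigenspaces of the single operator `descending k` are independent; this replaces a full weight
space decomposition. -/
lemma eq_zero_of_mem_below {R : CRep (gl k) M} {c : ℂ} {v : M}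
    (hv : v ∈ Module.End.eigenspace (R (descending k)) c) (hv' : v ∈ below R c) : v = 0 := by
  have h := (Module.End.eigenspaces_iSupIndep (R (descending k))) c
  refine Submodule.disjoint_def.1 h v hv ?_
  have : below R c ≤ ⨆ d, ⨆ (_ : d ≠ c), Module.End.eigenspace (R (descending k)) d := by
    refine iSup_le fun n => ?_
    refine le_iSup₂_of_le (c - (n + 1 : ℕ)) ?_ le_rfl
    rw [Ne, sub_eq_self]
    exact Nat.cast_ne_zero.2 (Nat.succ_ne_zero n)
  exact this hv'

lemma IsHighestWeightVector.mem_eigenspace {R : CRep (gl k) M} {μ : Fin k → ℝ} {v : M}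
    (hv : IsHighestWeightVector R μ v) : v ∈ Module.End.eigenspace (R (descending k))
      ((∑ a, μ a * descending k a a : ℝ) : ℂ) :=
  Module.End.mem_eigenspace_iff.2 (hv.diag _ (Matrix.isDiag_diagonal _))

lemma Intertwines.isHighestWeightVector {R : CRep (gl k) M} {S : CRep (gl k) N} {f : M →ₗ[ℂ] N}
    (hf : Intertwines R S f) {μ : Fin k → ℝ} {v : M} (hv : IsHighestWeightVector R μ v) :
    IsHighestWeightVector S μ (f v) where
  diag h hh := by rw [← hf, hv.diag h hh, map_smul]
  upper n hn := by rw [← hf, hv.upper n hn, map_zero]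

lemma IsHighestWeightVector.sub {R : CRep (gl k) M} {μ : Fin k → ℝ} {v w : M}
    (hv : IsHighestWeightVector R μ v) (hw : IsHighestWeightVector R μ w) :
    IsHighestWeightVector R μ (v - w) where
  diag h hh := by rw [map_sub, hv.diag h hh, hw.diag h hh, smul_sub]
  upper n hn := by rw [map_sub, hv.upper n hn, hw.upper n hn, sub_zero]

lemma IsHighestWeightVector.smul {R : CRep (gl k) M} {μ : Fin k → ℝ} {v : M}
    (hv : IsHighestWeightVector R μ v) (c : ℂ) : IsHighestWeightVector R μ (c • v) where
  diag h hh := by rw [map_smul, hv.diag h hh, smul_comm]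
  upper n hn := by rw [map_smul, hv.upper n hn, smul_zero]

end HighestWeight

/-! ### Contravariant inner products, complements and embeddings. -/

section Contravariant

variable {k : ℕ} {M : Type*} [AddCommGroup M] [Module ℂ M] {N : Type*} [AddCommGroup N] [Module ℂ N]

/-- A positive definite Hermitian form for which the adjoint of a real matrix is its transpose. -/
structure IsContravariant (R : CRep (gl k) M) (B : M → M →ₗ[ℂ] ℂ) : Prop where
  conj_symm : ∀ u v, starRingEnd ℂ (B u v) = B v u
  re_pos : ∀ u, u ≠ 0 → 0 < (B u u).re
  apply_left : ∀ (x : gl k) u v, B (R x u) v = B u (R x.transpose v)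

lemma IsContravariant.comp {R : CRep (gl k) M} {S : CRep (gl k) N} {B : N → N →ₗ[ℂ] ℂ}
    (hB : IsContravariant S B) {f : M →ₗ[ℂ] N} (hf : Intertwines R S f)
    (hinj : Function.Injective f) : IsContravariant R (fun u => B (f u) ∘ₗ f) where
  conj_symm u v := hB.conj_symm _ _
  re_pos u hu := hB.re_pos _ fun h => hu (hinj (h.trans f.map_zero.symm))
  apply_left x u v := by
    simp only [LinearMap.comp_apply]
    rw [hf, hf, hB.apply_left]

lemma IsContravariant.add_left {R : CRep (gl k) M} {B : M → M →ₗ[ℂ] ℂ}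
    (hB : IsContravariant R B) (u v w : M) : B (u + v) w = B u w + B v w := by
  rw [← hB.conj_symm, map_add, map_add, hB.conj_symm, hB.conj_symm]

lemma IsContravariant.smul_left {R : CRep (gl k) M} {B : M → M →ₗ[ℂ] ℂ}
    (hB : IsContravariant R B) (c : ℂ) (u v : M) : B (c • u) v = starRingEnd ℂ c * B u v := by
  rw [← hB.conj_symm, map_smul, smul_eq_mul, map_mul, hB.conj_symm]

lemma IsContravariant.zero_left {R : CRep (gl k) M} {B : M → M →ₗ[ℂ] ℂ}
    (hB : IsContravariant R B) (v : M) : B 0 v = 0 := by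
  rw [← hB.conj_symm, map_zero, map_zero]

lemma IsContravariant.self_ne_zero {R : CRep (gl k) M} {B : M → M →ₗ[ℂ] ℂ}
    (hB : IsContravariant R B) {u : M} (hu : u ≠ 0) : B u u ≠ 0 := fun h => by
  have := hB.re_pos u hu
  rw [h] at this
  exact lt_irrefl _ this

/-- An invariant finite-dimensional subspace has an invariant complement. -/
lemma IsContravariant.exists_isCompl {R : CRep (gl k) M} {B : M → M →ₗ[ℂ] ℂ}
    (hB : IsContravariant R B) {p : Submodule ℂ M} [FiniteDimensional ℂ p]
    (hp : IsInvariant R p) : ∃ q : Submodule ℂ M, IsInvariant R q ∧ IsCompl p q := by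
  let c : InnerProductSpace.Core ℂ M :=
    { inner := fun u v => B u v
      conj_inner_symm := fun u v => hB.conj_symm v u
      re_inner_nonneg := fun u => by
        by_cases hu : u = 0
        · simp [hu, hB.zero_left]
        · exact (hB.re_pos u hu).le
      add_left := fun u v w => hB.add_left u v w
      smul_left := fun u v r => hB.smul_left r u v
      definite := fun u hu => by
        by_contra h
        exact hB.self_ne_zero h hu }
  let _ : NormedAddCommGroup M := c.toNormedAddCommGroup
  let _ : InnerProductSpace ℂ M := InnerProductSpace.ofCore c.toCore
  -- The adjoint of a real matrix is again a real matrix, so the orthogonal complement is invariant.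
  refine ⟨pᗮ, fun x w hw => ?_, Submodule.isCompl_orthogonal p⟩
  rw [Submodule.mem_orthogonal] at hw ⊢
  intro u hu
  have h1 : B u (R x w) = B (R x.transpose u) w := by
    rw [hB.apply_left, Matrix.transpose_transpose]
  exact h1.trans (hw _ (hp _ u hu))

/-- The direct sum of two representations. -/
noncomputable def prodRep (R : CRep (gl k) M) (S : CRep (gl k) N) : CRep (gl k) (M × N) where
  toFun x := (R x).prodMap (S x)
  map_add' x y := by ext <;> simp
  map_smul' c x := by ext <;> simp
  map_lie' := by
    intro x y
    rw [LieHom.map_lie, LieHom.map_lie]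
    ext <;> simp [LieRing.of_associative_ring_bracket]

lemma prodRep_apply (R : CRep (gl k) M) (S : CRep (gl k) N) (x : gl k) (p : M × N) :
    prodRep R S x p = (R x p.1, S x p.2) := rfl

/-- An irreducible highest weight representation embeds into every representation with a positive
definite contravariant form and a highest weight vector of the same weight. -/
lemma IsContravariant.exists_embedding {R : CRep (gl k) M} {S : CRep (gl k) N}
    {B : N → N →ₗ[ℂ] ℂ} (hB : IsContravariant S B) (hR : IsIrreducible R) {μ : Fin k → ℝ}
    {u : M} (hu : IsHighestWeightVector R μ u) (hu0 : u ≠ 0)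
    {t : N} (ht : IsHighestWeightVector S μ t) (ht0 : t ≠ 0) :
    ∃ f : M →ₗ[ℂ] N, Intertwines R S f ∧ Function.Injective f ∧ f u = t := by
  -- The subrepresentation generated by `(u, t)` will turn out to be the graph of the embedding.
  set G := lowerSpan (prodRep R S) (u, t)
  have hut : IsHighestWeightVector (prodRep R S) μ (u, t) :=
    { diag := fun h hh => by rw [prodRep_apply, hu.diag h hh, ht.diag h hh]; rfl
      upper := fun n hn => by rw [prodRep_apply, hu.upper n hn, ht.upper n hn]; rfl }
  have hGinv : IsInvariant (prodRep R S) G := hut.isInvariant_lowerSpan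
  set c : ℂ := ((∑ a, μ a * descending k a a : ℝ) : ℂ)
  -- The same `α` measures the top part of both coordinates: lowering sends the first into `below`
  -- and the second into the orthogonal complement of `t`, because raising operators kill `t`.
  have hGle : ∀ p ∈ G, ∃ α : ℂ, p.1 - α • u ∈ below R c ∧ B t p.2 = α * B t t := by
    have : G ≤
      { carrier := {p | ∃ α : ℂ, p.1 - α • u ∈ below R c ∧ B t p.2 = α * B t t}
        add_mem' := by
          rintro p q ⟨α, h1, h2⟩ ⟨β, h3, h4⟩
          refine ⟨α + β, ?_, by rw [Prod.snd_add, map_add, h2, h4, add_mul]⟩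
          have := add_mem h1 h3
          rwa [show (p + q).1 - (α + β) • u = p.1 - α • u + (q.1 - β • u) by
            rw [Prod.fst_add, add_smul]; abel]
        zero_mem' := ⟨0, by simp, by simp⟩
        smul_mem' := by
          rintro r p ⟨α, h1, h2⟩
          refine ⟨r * α, ?_, by
            change B t (r • p.2) = _
            rw [map_smul, h2, smul_eq_mul, mul_assoc]⟩
          change r • p.1 - _ ∈ _
          rw [mul_smul, ← smul_sub]
          exact Submodule.smul_mem _ _ h1 } := by
      refine lowerSpan_le ⟨1, by simp, by simp⟩ ?_
      rintro a b hab p ⟨α, h1, h2⟩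
      refine ⟨0, ?_, ?_⟩
      · rw [prodRep_apply, zero_smul, sub_zero]
        have h3 : p.1 = α • u + (p.1 - α • u) := by abel
        rw [h3, map_add, map_smul]
        exact add_mem (Submodule.smul_mem _ _ (eigenspace_lower_le_below R hab hu.mem_eigenspace))
          (lowerStable_below R c a b hab _ h1)
      · rw [prodRep_apply, zero_mul]
        have h3 := hB.apply_left (Matrix.single a b 1) t p.2
        rw [Matrix.transpose_single, ht.upper _ (fun r s hsr => by
          rw [Matrix.single_apply, if_neg]
          rintro ⟨rfl, rfl⟩
          exact absurd hab hsr.not_gt), hB.zero_left] at h3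
        exact h3.symm
    exact fun p hp => this hp
  have hker : ∀ y, ((0 : M), y) ∈ G → B t y = 0 := by
    intro y hy
    obtain ⟨α, h1, h2⟩ := hGle _ hy
    rw [zero_sub, ← neg_smul] at h1
    have h3 := eq_zero_of_mem_below (Submodule.smul_mem _ _ hu.mem_eigenspace) h1
    rcases smul_eq_zero.1 h3 with h | h
    · rw [h2, neg_eq_zero.1 h, zero_mul]
    · exact absurd h hu0
  have hfst : G.map (LinearMap.fst ℂ M N) = ⊤ := by
    refine hu.eq_top hR hu0 ⟨(u, t), mem_lowerSpan_self _ _, rfl⟩ ?_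
    rintro a b hab _ ⟨p, hp, rfl⟩
    exact ⟨prodRep R S _ p, hGinv _ _ hp, rfl⟩
  -- The `y` with `(0, y) ∈ G` form an invariant subspace orthogonal to `t`, hence orthogonal to the
  -- second coordinate of everything in `G`, and in particular to itself.
  have hzero : ∀ y, ((0 : M), y) ∈ G → y = 0 := by
    intro y hy
    have hle : G ≤
      { carrier := {p | ∀ z, ((0 : M), z) ∈ G → B p.2 z = 0}
        add_mem' := fun h1 h2 z hz => by
          rw [Prod.snd_add, hB.add_left, h1 z hz, h2 z hz, add_zero]
        zero_mem' := fun z _ => hB.zero_left z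
        smul_mem' := fun r p h z hz => by
          change B (r • p.2) z = 0
          rw [hB.smul_left, h z hz, mul_zero] } := by
      refine lowerSpan_le hker ?_
      intro a b _ p hp z hz
      rw [prodRep_apply, hB.apply_left]
      refine hp _ ?_
      have := hGinv (Matrix.single b a 1).transpose _ hz
      rwa [prodRep_apply, map_zero] at this
    by_contra h
    exact hB.self_ne_zero h (hle hy y hy)
  let e : G ≃ₗ[ℂ] M := LinearEquiv.ofBijective ((LinearMap.fst ℂ M N).domRestrict G) <| by
    constructor
    · rw [← LinearMap.ker_eq_bot, LinearMap.ker_eq_bot']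
      rintro ⟨⟨x, y⟩, hp⟩ hx
      have hx' : x = 0 := hx
      subst hx'
      have := hzero y hp
      subst this
      rfl
    · intro m
      obtain ⟨p, hp, rfl⟩ : m ∈ G.map (LinearMap.fst ℂ M N) := hfst ▸ Submodule.mem_top
      exact ⟨⟨p, hp⟩, rfl⟩
  let f : M →ₗ[ℂ] N := LinearMap.snd ℂ M N ∘ₗ G.subtype ∘ₗ e.symm.toLinearMap
  have hfG : ∀ p ∈ G, f p.1 = p.2 := by
    intro p hp
    have h1 : e.symm p.1 = ⟨p, hp⟩ := by rw [LinearEquiv.symm_apply_eq]; rfl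
    change ((e.symm p.1 : G) : M × N).2 = p.2
    rw [h1]
  have hex : ∀ m, ∃ y, (m, y) ∈ G := by
    intro m
    obtain ⟨p, hp, rfl⟩ : m ∈ G.map (LinearMap.fst ℂ M N) := hfst ▸ Submodule.mem_top
    exact ⟨p.2, hp⟩
  have hfint : Intertwines R S f := by
    intro x m
    obtain ⟨y, hy⟩ := hex m
    have h1 := hfG _ (hGinv x _ hy)
    rw [prodRep_apply] at h1
    rw [h1, ← hfG _ hy]
  have hfu : f u = t := hfG _ (mem_lowerSpan_self _ _)
  refine ⟨f, hfint, ?_, hfu⟩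
  rw [← LinearMap.ker_eq_bot]
  rcases hR.2 (LinearMap.ker f) (fun x w hw => by
    rw [LinearMap.mem_ker] at hw ⊢
    rw [hfint, hw, map_zero]) with h | h
  · exact h
  · have : u ∈ LinearMap.ker f := h ▸ Submodule.mem_top
    exact absurd (hfu.symm.trans (LinearMap.mem_ker.1 this)) ht0

/-- An embedding of a finite-dimensional representation into one with a positive definite
contravariant form has an equivariant left inverse. -/
lemma IsContravariant.exists_leftInverse {R : CRep (gl k) M} {S : CRep (gl k) N}
    {B : N → N →ₗ[ℂ] ℂ} (hB : IsContravariant S B) [FiniteDimensional ℂ M] {f : M →ₗ[ℂ] N}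
    (hf : Intertwines R S f) (hinj : Function.Injective f) :
    ∃ g : N →ₗ[ℂ] M, Intertwines S R g ∧ ∀ m, g (f m) = m := by
  have hinv : IsInvariant S (LinearMap.range f) := by
    rintro x _ ⟨m, rfl⟩
    exact ⟨R x m, hf x m⟩
  obtain ⟨q, hq, hc⟩ := hB.exists_isCompl hinv
  let e := LinearEquiv.ofInjective f hinj
  let g : N →ₗ[ℂ] M := e.symm.toLinearMap ∘ₗ Submodule.projectionOnto _ _ hc
  have hgf : ∀ m, g (f m) = m := by
    intro m
    have : Submodule.projectionOnto _ _ hc (f m) = e m :=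
      Submodule.projectionOnto_apply_left hc (e m)
    simp [g, this]
  have hgq : ∀ n ∈ q, g n = 0 := by
    intro n hn
    simp [g, Submodule.projectionOnto_apply_of_mem_right hc hn]
  refine ⟨g, ?_, hgf⟩
  intro x n
  obtain ⟨_, ⟨m, rfl⟩, z, hz, rfl⟩ :=
    Submodule.mem_sup.1 (hc.sup_eq_top ▸ Submodule.mem_top : n ∈ LinearMap.range f ⊔ q)
  rw [map_add, map_add, map_add, ← hf, hgf, hgf, hgq z hz, hgq _ (hq x z hz), add_zero, add_zero]

end Contravariant

/-! ### The Fischer inner product. -/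

section Fischer

open MvPolynomial

variable {ι : Type*} [Fintype ι]

/-- The Fischer inner product of polynomials: monomials are orthogonal, and the square norm of
`X ^ s` is `s!`. -/
noncomputable def fischer (f : MvPolynomial ι ℂ) : MvPolynomial ι ℂ →ₗ[ℂ] ℂ :=
  ∑ s ∈ f.support, (starRingEnd ℂ (f.coeff s) * (∏ i, (s i).factorial : ℕ)) • lcoeff ℂ s

lemma fischer_apply_of_subset {f : MvPolynomial ι ℂ} {S : Finset (ι →₀ ℕ)} (hS : f.support ⊆ S)
    (g : MvPolynomial ι ℂ) :
    fischer f g = ∑ s ∈ S, starRingEnd ℂ (f.coeff s) * (∏ i, (s i).factorial : ℕ) * g.coeff s := by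
  rw [fischer, LinearMap.sum_apply]
  simp only [LinearMap.smul_apply, lcoeff_apply, smul_eq_mul]
  refine Finset.sum_subset hS fun s _ hs => ?_
  rw [notMem_support_iff.1 hs, map_zero, zero_mul, zero_mul]

lemma fischer_conj_symm (f g : MvPolynomial ι ℂ) :
    starRingEnd ℂ (fischer f g) = fischer g f := by
  classical
  rw [fischer_apply_of_subset (Finset.subset_union_left (s₂ := g.support)),
    fischer_apply_of_subset (Finset.subset_union_right (s₁ := f.support)), map_sum]
  refine Finset.sum_congr rfl fun s _ => ?_
  simp only [map_mul, Complex.conj_conj, map_natCast]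
  ring

lemma fischer_re_pos {f : MvPolynomial ι ℂ} (hf : f ≠ 0) : 0 < (fischer f f).re := by
  rw [fischer_apply_of_subset subset_rfl, Complex.re_sum]
  have key : ∀ s, (starRingEnd ℂ (f.coeff s) * (∏ i, (s i).factorial : ℕ) * f.coeff s).re =
      (∏ i, (s i).factorial : ℕ) * Complex.normSq (f.coeff s) := by
    intro s
    rw [mul_right_comm, ← Complex.normSq_eq_conj_mul_self, ← Complex.ofReal_natCast,
      ← Complex.ofReal_mul, Complex.ofReal_re, mul_comm]
  refine Finset.sum_pos (fun s hs => ?_) (support_nonempty.2 hf)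
  rw [key]
  exact mul_pos (Nat.cast_pos.2 (Finset.prod_pos fun i _ => Nat.factorial_pos _))
    (Complex.normSq_pos.2 (mem_support_iff.1 hs))

/-- Multiplication by a variable and differentiation are adjoint; the factorial weights are chosen
for this. -/
lemma fischer_X_mul (i : ι) (f g : MvPolynomial ι ℂ) :
    fischer (X i * f) g = fischer f (pderiv i g) := by
  classical
  rw [fischer_apply_of_subset subset_rfl, fischer_apply_of_subset subset_rfl, support_X_mul,
    Finset.sum_map]
  refine Finset.sum_congr rfl fun s _ => ?_
  rw [addLeftEmbedding_apply, coeff_X_mul, coeff_pderiv, add_comm (Finsupp.single i 1) s]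
  have : ∏ a, ((s + Finsupp.single i 1 : ι →₀ ℕ) a).factorial = (∏ a, (s a).factorial) * (s i + 1) := by
    rw [← Finset.mul_prod_erase _ _ (Finset.mem_univ i),
      ← Finset.mul_prod_erase _ (fun a => (s a).factorial) (Finset.mem_univ i)]
    rw [Finset.prod_congr rfl (g := fun a => (s a).factorial) (fun a ha => by
      rw [Finsupp.add_apply, Finsupp.single_eq_of_ne (Finset.ne_of_mem_erase ha), add_zero])]
    rw [Finsupp.add_apply, Finsupp.single_eq_same, Nat.factorial_succ]
    ring
  rw [this]
  push_cast
  ring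

lemma fischer_pderiv (i : ι) (f g : MvPolynomial ι ℂ) :
    fischer (pderiv i f) g = fischer f (X i * g) := by
  rw [← fischer_conj_symm, ← fischer_X_mul, fischer_conj_symm]

lemma fischer_add_left (f g h : MvPolynomial ι ℂ) :
    fischer (f + g) h = fischer f h + fischer g h := by
  rw [← fischer_conj_symm, map_add, map_add, fischer_conj_symm, fischer_conj_symm]

lemma fischer_smul_left (c : ℂ) (f g : MvPolynomial ι ℂ) :
    fischer (c • f) g = starRingEnd ℂ c * fischer f g := by
  rw [← fischer_conj_symm, map_smul, smul_eq_mul, map_mul, fischer_conj_symm]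

lemma fischer_sum_left {α : Type*} (S : Finset α) (f : α → MvPolynomial ι ℂ)
    (g : MvPolynomial ι ℂ) : fischer (∑ a ∈ S, f a) g = ∑ a ∈ S, fischer (f a) g := by
  rw [← fischer_conj_symm, map_sum, map_sum]
  simp only [fischer_conj_symm]

end Fischer

/-! ### The polynomial representation. -/

section PolyRep

open MvPolynomial

/-- Polynomials in the entries of a `k × k` matrix. -/
abbrev MatPoly (k : ℕ) := MvPolynomial (Fin k × Fin k) ℂ

variable {k : ℕ}

/-- The derivation of `MatPoly k` by which the matrix `x` acts on each column of variables as on the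
standard basis of `ℂᵏ`. -/
noncomputable def polyDer (x : gl k) : Derivation ℂ (MatPoly k) (MatPoly k) :=
  ∑ p, ∑ q, ∑ c, (x p q : ℂ) • (X (p, c) : MatPoly k) • pderiv (q, c)

lemma polyDer_apply (x : gl k) (f : MatPoly k) :
    polyDer x f = ∑ p, ∑ q, ∑ c, (x p q : ℂ) • ((X (p, c) : MatPoly k) * pderiv (q, c) f) := by
  have h : ∀ {α : Type} (S : Finset α) (D : α → Derivation ℂ (MatPoly k) (MatPoly k)),
      (∑ a ∈ S, D a) f = ∑ a ∈ S, D a f := fun S D =>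
    map_sum ((Pi.evalAddMonoidHom _ f).comp Derivation.coeFnAddMonoidHom) D S
  simp only [polyDer, h, Derivation.smul_apply, smul_eq_mul]

lemma polyDer_X (x : gl k) (r c : Fin k) :
    polyDer x (X (r, c)) = ∑ p, (x p r : ℂ) • (X (p, c) : MatPoly k) := by
  rw [polyDer_apply]
  refine Finset.sum_congr rfl fun p _ => ?_
  rw [Finset.sum_eq_single r, Finset.sum_eq_single c]
  · rw [pderiv_X_self, mul_one]
  · intro d _ hd
    rw [pderiv_X_of_ne (by simpa using hd.symm), mul_zero, smul_zero]
  · simp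
  · intro q _ hq
    refine Finset.sum_eq_zero fun d _ => ?_
    rw [pderiv_X_of_ne (by simp [hq.symm]), mul_zero, smul_zero]
  · simp

lemma polyDer_add (x y : gl k) : polyDer (x + y) = polyDer x + polyDer y := by
  refine derivation_ext fun ⟨r, c⟩ => ?_
  simp only [Derivation.add_apply, polyDer_X, Matrix.add_apply, Complex.ofReal_add, add_smul,
    Finset.sum_add_distrib]

lemma polyDer_smul (a : ℝ) (x : gl k) : polyDer (a • x) = (a : ℂ) • polyDer x := by
  refine derivation_ext fun ⟨r, c⟩ => ?_
  simp only [Derivation.smul_apply, polyDer_X, Matrix.smul_apply, smul_eq_mul, Complex.ofReal_mul,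
    mul_smul, Finset.smul_sum]

lemma polyDer_lie (x y : gl k) : polyDer ⁅x, y⁆ = ⁅polyDer x, polyDer y⁆ := by
  have key : ∀ (x y : gl k) (r c : Fin k), polyDer x (polyDer y (X (r, c))) =
      ∑ p, ((x * y) p r : ℂ) • (X (p, c) : MatPoly k) := by
    intro x y r c
    simp only [polyDer_X, map_sum, Derivation.map_smul, Finset.smul_sum, smul_smul, Matrix.mul_apply,
      Complex.ofReal_sum, Complex.ofReal_mul, Finset.sum_smul]
    rw [Finset.sum_comm]
    simp only [mul_comm]
  refine derivation_ext fun ⟨r, c⟩ => ?_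
  rw [Derivation.commutator_apply, key, key, polyDer_X, ← Finset.sum_sub_distrib]
  refine Finset.sum_congr rfl fun p _ => ?_
  rw [LieRing.of_associative_ring_bracket, Matrix.sub_apply, Complex.ofReal_sub, sub_smul]

/-- The action of `𝔤𝔩(k, ℝ)` on polynomials, twisted by `c` times the trace. -/
noncomputable def polyRep (k : ℕ) (c : ℝ) : CRep (gl k) (MatPoly k) where
  toFun x := (polyDer x : MatPoly k →ₗ[ℂ] MatPoly k) + ((c * x.trace : ℝ) : ℂ) • 1
  map_add' x y := by
    rw [polyDer_add, Derivation.coe_add_linearMap, Matrix.trace_add, mul_add, Complex.ofReal_add]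
    module
  map_smul' a x := by
    rw [polyDer_smul, Derivation.coe_smul_linearMap, Matrix.trace_smul, RingHom.id_apply,
      smul_add, smul_eq_mul, mul_left_comm, Complex.ofReal_mul a, mul_smul, Complex.coe_smul a,
      ← Complex.coe_smul a (polyDer x : MatPoly k →ₗ[ℂ] MatPoly k)]
  map_lie' := by
    intro x y
    rw [polyDer_lie, LieAlgebra.matrix_trace_commutator_zero]
    refine LinearMap.ext fun f => ?_
    simp only [LieRing.of_associative_ring_bracket, LinearMap.add_apply, LinearMap.sub_apply,
      Module.End.mul_apply, LinearMap.smul_apply, Module.End.one_apply, Derivation.coeFn_coe,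
      mul_zero, LinearMap.zero_apply, Complex.ofReal_zero, zero_smul, map_add, map_smul]
    rw [Derivation.commutator_apply]
    module

lemma polyRep_apply (c : ℝ) (x : gl k) (f : MatPoly k) :
    polyRep k c x f = polyDer x f + ((c * x.trace : ℝ) : ℂ) • f := rfl

/-- The adjoint of `X (p, c) ∂_(q, c)` is `X (q, c) ∂_(p, c)`, which transposes the matrix; the
twist is a real scalar invariant under transposition. -/
lemma isContravariant_fischer (c : ℝ) : IsContravariant (polyRep k c) fischer where
  conj_symm := fischer_conj_symm
  re_pos _ := fischer_re_pos
  apply_left x f g := by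
    rw [polyRep_apply, polyRep_apply, fischer_add_left, map_add, fischer_smul_left, map_smul,
      Complex.conj_ofReal, Matrix.trace_transpose, smul_eq_mul, add_left_inj, polyDer_apply,
      polyDer_apply]
    simp only [fischer_sum_left, map_sum, fischer_smul_left, Complex.conj_ofReal, map_smul,
      smul_eq_mul, fischer_X_mul, fischer_pderiv, Matrix.transpose_apply]
    rw [Finset.sum_comm]

end PolyRep

/-! ### Derivatives of determinants. -/

section DetDerivation

variable {R A : Type*} [CommRing R] [CommRing A] [Algebra R A]

lemma derivation_prod {ι : Type*} [DecidableEq ι] (D : Derivation R A A) (s : Finset ι)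
    (f : ι → A) : D (∏ i ∈ s, f i) = ∑ i ∈ s, D (f i) * ∏ j ∈ s.erase i, f j := by
  induction s using Finset.induction_on with
  | empty => simp
  | insert a s ha ih =>
    rw [Finset.prod_insert ha, D.leibniz, ih, Finset.sum_insert ha, Finset.erase_insert ha,
      smul_eq_mul, smul_eq_mul, Finset.mul_sum, add_comm, mul_comm (∏ i ∈ s, f i)]
    congr 1
    refine Finset.sum_congr rfl fun i hi => ?_
    have hai : a ≠ i := fun h => ha (h ▸ hi)
    rw [Finset.erase_insert_of_ne hai, Finset.prod_insert (fun h => ha (Finset.mem_of_mem_erase h))]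
    ring

variable {n : Type*} [Fintype n] [DecidableEq n]

lemma derivation_det (D : Derivation R A A) (M : Matrix n n A) :
    D M.det = ∑ c, M.cramer (fun r => D (M r c)) c := by
  simp only [Matrix.cramer_apply]
  simp only [Matrix.det_apply, map_sum]
  rw [Finset.sum_comm]
  refine Finset.sum_congr rfl fun σ _ => ?_
  rw [Units.smul_def, map_zsmul, derivation_prod, Finset.smul_sum]
  refine Finset.sum_congr rfl fun c _ => ?_
  rw [← Units.smul_def, ← Finset.mul_prod_erase _ _ (Finset.mem_univ c), Matrix.updateCol_self]
  congr 2
  refine Finset.prod_congr rfl fun j hj => ?_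
  rw [Matrix.updateCol_ne (Finset.ne_of_mem_erase hj)]

/-- The sum is the trace of `adj(M) y M`, and traces are cyclic. -/
lemma sum_cramer_mul_col (y M : Matrix n n A) :
    ∑ c, M.cramer (fun r => (y * M) r c) c = y.trace * M.det := by
  have h : ∀ c, M.cramer (fun r => (y * M) r c) c = (M.adjugate * (y * M)) c c := by
    intro c
    rw [Matrix.cramer_eq_adjugate_mulVec]
    rfl
  simp only [h]
  change Matrix.trace _ = _
  rw [Matrix.trace_mul_comm, Matrix.mul_assoc, Matrix.mul_adjugate, Matrix.mul_smul,
    Matrix.mul_one, Matrix.trace_smul, smul_eq_mul, mul_comm]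

end DetDerivation

/-! ### Minors and their polarisations. -/

section Minor

open MvPolynomial

variable {k : ℕ}

/-- The `k × k` matrix whose first `n` columns consist of variables, and whose later columns `c` are
the standard basis vectors with index `f c`. -/
noncomputable def partialMatrix (n : ℕ) (f : Fin k → Fin k) :
    Matrix (Fin k) (Fin k) (MatPoly k) :=
  Matrix.of fun r c => if (c : ℕ) < n then X (r, c) else if r = f c then 1 else 0

/-- The determinant of `partialMatrix n f`. -/
noncomputable def minor (n : ℕ) (f : Fin k → Fin k) : MatPoly k := (partialMatrix n f).det

lemma partialMatrix_update {n : ℕ} (f : Fin k → Fin k) {c : Fin k} (hc : n ≤ c) (q : Fin k) :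
    partialMatrix n (Function.update f c q) = (partialMatrix n f).updateCol c (Pi.single q 1) := by
  ext1 r d
  by_cases hd : d = c
  · subst hd
    simp [partialMatrix, hc.not_gt, Pi.single_apply]
  · simp [partialMatrix, hd]

lemma minor_update {n : ℕ} (f : Fin k → Fin k) {c : Fin k} (hc : n ≤ c) (q : Fin k) :
    minor n (Function.update f c q) = (partialMatrix n f).cramer (Pi.single q 1) c := by
  rw [minor, partialMatrix_update f hc, Matrix.cramer_apply]

lemma minor_eq_zero {n : ℕ} {f : Fin k → Fin k} {c d : Fin k} (hc : n ≤ c) (hd : n ≤ d)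
    (hcd : c ≠ d) (h : f c = f d) : minor n f = 0 :=
  Matrix.det_zero_of_column_eq hcd fun r => by simp [partialMatrix, hc.not_gt, hd.not_gt, h]

/-- If `xᵀ` acted on every column, the result would be the trace times the minor. The derivation
moves only the columns of variables, so the contribution of the constant columns is subtracted. -/
lemma polyDer_minor (x : gl k) (n : ℕ) (f : Fin k → Fin k) :
    polyDer x (minor n f) = (x.trace : ℂ) • minor n f -
      ∑ c : Fin k, if n ≤ c then ∑ q, (x (f c) q : ℂ) • minor n (Function.update f c q) else 0 := by
  let y : Matrix (Fin k) (Fin k) (MatPoly k) := Matrix.of fun r p => C (x p r : ℂ)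
  have hy : y.trace * minor n f = (x.trace : ℂ) • minor n f := by
    rw [smul_eq_C_mul]
    congr 1
    simp [y, Matrix.trace]
  rw [← hy, minor, derivation_det, ← sum_cramer_mul_col, ← Finset.sum_sub_distrib]
  refine Finset.sum_congr rfl fun c _ => ?_
  by_cases hc : n ≤ c
  · have h1 : (fun r => polyDer x (partialMatrix n f r c)) = 0 := by
      funext r
      simp only [partialMatrix, Matrix.of_apply, if_neg hc.not_gt, Pi.zero_apply]
      split_ifs <;> simp
    have h2 : (fun r => (y * partialMatrix n f) r c) =
        ∑ q, (C (x (f c) q : ℂ) : MatPoly k) • (Pi.single q 1 : Fin k → MatPoly k) := by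
      funext r
      simp [Matrix.mul_apply, y, partialMatrix, hc.not_gt, Finset.sum_apply, Pi.single_apply]
    rw [h1, h2, map_zero, if_pos hc, map_sum, Finset.sum_apply, Pi.zero_apply, eq_comm,
      sub_eq_zero]
    refine Finset.sum_congr rfl fun q _ => ?_
    rw [map_smul, Pi.smul_apply, minor_update f hc, smul_eq_C_mul, smul_eq_mul]
  · rw [if_neg hc, sub_zero]
    refine congrArg (fun v => (partialMatrix n f).cramer v c) (funext fun r => ?_)
    simp [partialMatrix, not_le.1 hc, Matrix.mul_apply, y, polyDer_X, smul_eq_C_mul]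

/-- Its value at the identity matrix is `1`. -/
lemma minor_id_ne_zero (n : ℕ) : minor n (id : Fin k → Fin k) ≠ 0 := by
  intro h
  have h1 : eval (fun rc : Fin k × Fin k => (1 : Matrix (Fin k) (Fin k) ℂ) rc.1 rc.2)
      (minor n id) = 0 := by rw [h, map_zero]
  rw [minor, RingHom.map_det] at h1
  have h2 : RingHom.mapMatrix
      (eval (fun rc : Fin k × Fin k => (1 : Matrix (Fin k) (Fin k) ℂ) rc.1 rc.2))
      (partialMatrix n id) = 1 := by
    ext r c
    simp only [partialMatrix, RingHom.mapMatrix_apply, Matrix.map_apply, Matrix.of_apply, id]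
    split_ifs
    · simp
    all_goals simp_all [Matrix.one_apply]
  rw [h2, Matrix.det_one] at h1
  exact one_ne_zero h1

/-- The sum of the diagonal entries of `x` with index below `n`. -/
def diagSum (n : ℕ) (x : gl k) : ℝ := ∑ a : Fin k, if (a : ℕ) < n then x a a else 0

lemma trace_sub_diagSum (n : ℕ) (x : gl k) :
    (x.trace : ℂ) - ∑ c : Fin k, (if n ≤ c then (x c c : ℂ) else 0) = diagSum n x := by
  rw [diagSum, Matrix.trace, Complex.ofReal_sum, Complex.ofReal_sum, ← Finset.sum_sub_distrib]
  refine Finset.sum_congr rfl fun c _ => ?_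
  rcases lt_or_ge (c : ℕ) n with h | h
  · simp [h, h.not_ge]
  · simp [h, h.not_gt]

lemma polyDer_minor_of_isDiag {x : gl k} (hx : x.IsDiag) (n : ℕ) (f : Fin k → Fin k) :
    polyDer x (minor n f) = ((x.trace : ℂ) -
      ∑ c : Fin k, if n ≤ c then (x (f c) (f c) : ℂ) else 0) • minor n f := by
  rw [polyDer_minor, sub_smul, Finset.sum_smul]
  congr 1
  refine Finset.sum_congr rfl fun c _ => ?_
  split_ifs
  · rw [Finset.sum_eq_single (f c), Function.update_eq_self]
    · intro q _ hq
      rw [hx hq.symm, Complex.ofReal_zero, zero_smul]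
    · simp
  · rw [zero_smul]

lemma polyDer_minor_id_of_isDiag {x : gl k} (hx : x.IsDiag) (n : ℕ) :
    polyDer x (minor n id) = (diagSum n x : ℂ) • minor n (id : Fin k → Fin k) := by
  rw [polyDer_minor_of_isDiag hx, ← trace_sub_diagSum]
  rfl

/-- Columns after the first `n` on which `f` is the identity do not contribute to the action of a
strictly upper triangular matrix. -/
lemma upper_column_eq_zero {x : gl k} (hx : ∀ a b : Fin k, b ≤ a → x a b = 0) {n : ℕ}
    {f : Fin k → Fin k} {c : Fin k} (hc : n ≤ c) (hf : ∀ d, c ≤ d → f d = d) :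
    ∑ q, (x (f c) q : ℂ) • minor n (Function.update f c q) = 0 := by
  refine Finset.sum_eq_zero fun q _ => ?_
  rw [hf c le_rfl]
  -- For `q ≤ c` the coefficient vanishes; for `q > c` the column `q` already holds the same basis
  -- vector.
  rcases le_or_gt q c with h | h
  · rw [hx c q h, Complex.ofReal_zero, zero_smul]
  · rw [minor_eq_zero (c := c) (d := q) hc (hc.trans h.le) h.ne, smul_zero]
    rw [Function.update_self, Function.update_of_ne h.ne', hf q h.le]

lemma trace_eq_zero_of_upper {x : gl k} (hx : ∀ a b : Fin k, b ≤ a → x a b = 0) : x.trace = 0 :=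
  Finset.sum_eq_zero fun a _ => hx a a le_rfl

lemma polyDer_minor_id_of_upper {x : gl k} (hx : ∀ a b : Fin k, b ≤ a → x a b = 0) (n : ℕ) :
    polyDer x (minor n (id : Fin k → Fin k)) = 0 := by
  rw [polyDer_minor, trace_eq_zero_of_upper hx, Complex.ofReal_zero, zero_smul, zero_sub,
    neg_eq_zero]
  refine Finset.sum_eq_zero fun c _ => ?_
  split_ifs with hc
  · exact upper_column_eq_zero hx hc fun _ _ => rfl
  · rfl

/-- The minor with the first `i` columns of variables and the `b`-th basis vector after them. -/
noncomputable def polarMinor (i b : Fin k) : MatPoly k := minor i (Function.update id i b)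

lemma polarMinor_self (i : Fin k) : polarMinor i i = minor i id := by
  rw [polarMinor]
  congr 1
  exact Function.update_eq_self i id

lemma polarMinor_of_gt {i b : Fin k} (h : i < b) : polarMinor i b = 0 :=
  minor_eq_zero (c := i) (d := b) le_rfl h.le h.ne (by simp [h.ne'])

/-- Equivalently, the sum over `b` of `e_b ⊗ polarMinor i b` is annihilated by strictly upper
triangular matrices: the minors transform like coordinates dual to `ℂᵏ`. -/
lemma polyDer_polarMinor_of_upper {x : gl k} (hx : ∀ a b : Fin k, b ≤ a → x a b = 0)
    (i b : Fin k) : polyDer x (polarMinor i b) = -∑ d, (x b d : ℂ) • polarMinor i d := by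
  rw [polarMinor, polyDer_minor, trace_eq_zero_of_upper hx, Complex.ofReal_zero, zero_smul,
    zero_sub, neg_inj, Finset.sum_eq_single i]
  · simp [polarMinor]
  · intro c _ hc
    split_ifs with h
    · have hic : i < c := lt_of_le_of_ne h hc.symm
      exact upper_column_eq_zero hx h fun d hd => by
        rw [Function.update_of_ne (hic.trans_le hd).ne', id]
    · rfl
  · simp

lemma sum_diag_update (n : ℕ) (x : gl k) (f : Fin k → Fin k) {i : Fin k} (hi : n ≤ i)
    (b : Fin k) :
    (∑ c : Fin k, if n ≤ c then (x (Function.update f i b c) (Function.update f i b c) : ℂ) else 0)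
      = (∑ c : Fin k, if n ≤ c then (x (f c) (f c) : ℂ) else 0) + x b b - x (f i) (f i) := by
  rw [← Finset.add_sum_erase _ _ (Finset.mem_univ i),
    ← Finset.add_sum_erase Finset.univ (fun c : Fin k => if n ≤ c then (x (f c) (f c) : ℂ) else 0)
      (Finset.mem_univ i), if_pos hi, if_pos hi, Function.update_self,
    Finset.sum_congr rfl (g := fun c : Fin k => if n ≤ c then (x (f c) (f c) : ℂ) else 0)
      (fun c hc => by rw [Function.update_of_ne (Finset.ne_of_mem_erase hc)])]
  ring

lemma polyDer_polarMinor_of_isDiag {x : gl k} (hx : x.IsDiag) (i b : Fin k) :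
    polyDer x (polarMinor i b) =
      ((diagSum i x : ℂ) + x i i - x b b) • polarMinor i b := by
  rw [polarMinor, polyDer_minor_of_isDiag hx, sum_diag_update _ x id le_rfl, ← trace_sub_diagSum]
  congr 1
  simp only [id]
  ring

/-- The minor with the first `i` columns of variables and the basis vectors with index `b` and `c`
in the columns `i` and `j`. -/
noncomputable def polarMinor₂ (i j b c : Fin k) : MatPoly k :=
  minor i (Function.update (Function.update id i b) j c)

lemma polarMinor₂_self {i j : Fin k} (hij : i < j) : polarMinor₂ i j i j = minor i id := by
  rw [polarMinor₂]
  congr 1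
  funext c
  by_cases hc : c = j
  · simp [hc]
  · by_cases hc' : c = i
    · simp [hc', hij.ne]
    · simp [hc, hc']

lemma minor_comp_swap {n : ℕ} (f : Fin k → Fin k) {i j : Fin k} (hi : n ≤ i) (hj : n ≤ j)
    (hij : i ≠ j) : minor n (f ∘ Equiv.swap i j) = -minor n f := by
  have h : partialMatrix n (f ∘ Equiv.swap i j) =
      (partialMatrix n f).submatrix id (Equiv.swap i j) := by
    ext1 r c
    by_cases hci : c = i
    · simp [partialMatrix, hci, hi.not_gt, hj.not_gt]
    · by_cases hcj : c = j
      · simp [partialMatrix, hcj, hi.not_gt, hj.not_gt]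
      · simp [partialMatrix, Equiv.swap_apply_of_ne_of_ne hci hcj]
  rw [minor, h, Matrix.det_permute', Equiv.Perm.sign_swap hij]
  simp [minor]

lemma polarMinor₂_swap {i j : Fin k} (hij : i < j) (b c : Fin k) :
    polarMinor₂ i j c b = -polarMinor₂ i j b c := by
  rw [polarMinor₂, polarMinor₂, ← minor_comp_swap _ le_rfl hij.le hij.ne]
  congr 1
  funext d
  by_cases hdi : d = i
  · simp [hdi, hij.ne]
  · by_cases hdj : d = j
    · simp [hdj, hij.ne]
    · simp [hdi, hdj, Equiv.swap_apply_of_ne_of_ne hdi hdj]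

/-- As the columns `i` and `j` are adjacent, every other constant column lies after `j` and is
covered by `upper_column_eq_zero`; a column between them would escape that lemma. -/
lemma polyDer_polarMinor₂_of_upper {x : gl k} (hx : ∀ a b : Fin k, b ≤ a → x a b = 0)
    {i j : Fin k} (hij : (j : ℕ) = i + 1) (b c : Fin k) :
    polyDer x (polarMinor₂ i j b c) =
      -∑ d, ((x b d : ℂ) • polarMinor₂ i j d c + (x c d : ℂ) • polarMinor₂ i j b d) := by
  have hlt : i < j := Fin.lt_def.2 (by omega)
  rw [polarMinor₂, polyDer_minor, trace_eq_zero_of_upper hx, Complex.ofReal_zero, zero_smul,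
    zero_sub, neg_inj, ← Finset.add_sum_erase _ _ (Finset.mem_univ i),
    ← Finset.add_sum_erase _ _ (Finset.mem_erase.2 ⟨hlt.ne', Finset.mem_univ j⟩),
    Finset.sum_eq_zero (s := (Finset.univ.erase i).erase j), add_zero, if_pos le_rfl,
    if_pos (Fin.le_def.1 hlt.le), Finset.sum_add_distrib]
  · congr 1
    · refine Finset.sum_congr rfl fun d _ => ?_
      rw [Function.update_of_ne hlt.ne, Function.update_self, Function.update_comm hlt.ne',
        Function.update_idem, polarMinor₂]
    · refine Finset.sum_congr rfl fun d _ => ?_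
      rw [Function.update_self, Function.update_idem, polarMinor₂]
  · intro d hd
    split_ifs with h
    · rw [Finset.mem_erase, Finset.mem_erase] at hd
      have hjd : j < d := by
        have h1 : (d : ℕ) ≠ j := fun h => hd.1 (Fin.ext h)
        have h2 : (d : ℕ) ≠ i := fun h => hd.2.1 (Fin.ext h)
        exact Fin.lt_def.2 (by omega)
      exact upper_column_eq_zero hx h fun e he => by
        rw [Function.update_of_ne (hjd.trans_le he).ne',
          Function.update_of_ne (hlt.trans (hjd.trans_le he)).ne', id]
    · rfl

lemma polyDer_polarMinor₂_of_isDiag {x : gl k} (hx : x.IsDiag) {i j : Fin k} (hij : i < j)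
    (b c : Fin k) : polyDer x (polarMinor₂ i j b c) =
      ((diagSum i x : ℂ) + x i i + x j j - x b b - x c c) • polarMinor₂ i j b c := by
  rw [polarMinor₂, polyDer_minor_of_isDiag hx, sum_diag_update _ x _ hij.le,
    sum_diag_update _ x id le_rfl, ← trace_sub_diagSum, Function.update_of_ne hij.ne']
  congr 1
  simp only [id]
  ring

end Minor

/-! ### Highest weight polynomials of prescribed weight. -/

section PolyHighestWeight

open MvPolynomial

variable {k : ℕ}

/-- A polynomial on which the untwisted action of diagonal matrices is through `μ` and which is
annihilated by the strictly upper triangular matrices. -/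
structure IsHighestPoly (μ : Fin k → ℝ) (f : MatPoly k) : Prop where
  diag : ∀ h : gl k, h.IsDiag → polyDer h f = ((∑ a, μ a * h a a : ℝ) : ℂ) • f
  upper : ∀ n : gl k, (∀ a b : Fin k, b ≤ a → n a b = 0) → polyDer n f = 0

/-- The weight with entries `1` at the indices below `n` and `0` elsewhere. -/
def initialWeight (k n : ℕ) : Fin k → ℝ := fun a => if (a : ℕ) < n then 1 else 0

lemma sum_initialWeight (n : ℕ) (x : gl k) : ∑ a, initialWeight k n a * x a a = diagSum n x := by
  refine Finset.sum_congr rfl fun a _ => ?_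
  rw [initialWeight]
  split_ifs <;> simp

lemma isHighestPoly_minor (n : ℕ) : IsHighestPoly (initialWeight k n) (minor n id) where
  diag h hh := by rw [polyDer_minor_id_of_isDiag hh, sum_initialWeight]
  upper _ hx := polyDer_minor_id_of_upper hx n

lemma IsHighestPoly.mul {μ ν : Fin k → ℝ} {f g : MatPoly k} (hf : IsHighestPoly μ f)
    (hg : IsHighestPoly ν g) : IsHighestPoly (μ + ν) (f * g) where
  diag h hh := by
    rw [Derivation.leibniz, hf.diag h hh, hg.diag h hh]
    simp only [Pi.add_apply, add_mul, Finset.sum_add_distrib, Complex.ofReal_add, add_smul,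
      smul_eq_mul, mul_smul_comm]
    rw [mul_comm g f, add_comm]
  upper n hn := by rw [Derivation.leibniz, hf.upper n hn, hg.upper n hn, smul_zero, smul_zero,
    add_zero]

lemma isHighestPoly_one : IsHighestPoly (0 : Fin k → ℝ) 1 where
  diag h _ := by simp
  upper n _ := by simp

lemma IsHighestPoly.pow {μ : Fin k → ℝ} {f : MatPoly k} (hf : IsHighestPoly μ f) (m : ℕ) :
    IsHighestPoly (m • μ) (f ^ m) := by
  induction m with
  | zero => rw [zero_smul, pow_zero]; exact isHighestPoly_one
  | succ m ih => rw [succ_nsmul, pow_succ]; exact ih.mul hf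

lemma isHighestPoly_prod {α : Type*} (s : Finset α) (μ : α → Fin k → ℝ) (f : α → MatPoly k)
    (h : ∀ a ∈ s, IsHighestPoly (μ a) (f a)) :
    IsHighestPoly (∑ a ∈ s, μ a) (∏ a ∈ s, f a) := by
  classical
  induction s using Finset.induction_on with
  | empty => exact isHighestPoly_one
  | insert a s ha ih =>
    rw [Finset.sum_insert ha, Finset.prod_insert ha]
    exact (h a (Finset.mem_insert_self a s)).mul
      (ih fun b hb => h b (Finset.mem_insert_of_mem hb))

lemma IsHighestPoly.isHighestWeightVector {μ : Fin k → ℝ} {f : MatPoly k}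
    (hf : IsHighestPoly μ f) (c : ℝ) :
    IsHighestWeightVector (polyRep k c) (fun a => μ a + c) f where
  diag h hh := by
    rw [polyRep_apply, hf.diag h hh, ← add_smul, ← Complex.ofReal_add]
    congr 3
    rw [Matrix.trace, Finset.mul_sum, ← Finset.sum_add_distrib]
    exact Finset.sum_congr rfl fun a _ => (add_mul _ _ _).symm
  upper n hn := by
    rw [polyRep_apply, hf.upper n hn, trace_eq_zero_of_upper hn, mul_zero, Complex.ofReal_zero,
      zero_smul, add_zero]

/-- Up to a multiple of the trace, each dominant integral weight is the weight of a nonzero product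
of leading minors. -/
lemma IsDominantIntegral.exists_poly {ν : Fin k → ℝ} (hν : IsDominantIntegral ν) :
    ∃ (c : ℝ) (f : MatPoly k), f ≠ 0 ∧ IsHighestPoly (fun a => ν a - c) f := by
  rcases Nat.eq_zero_or_pos k with rfl | hk
  · refine ⟨0, 1, one_ne_zero, ?_⟩
    convert isHighestPoly_one using 1
  -- Clamping the index makes `ν` a sequence on `ℕ`, constant from the last entry on.
  let N : ℕ → ℝ := fun t => ν ⟨min t (k - 1), by omega⟩
  have hN : ∀ t, ∃ m : ℕ, N t - N (t + 1) = m := by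
    intro t
    by_cases ht : t < k - 1
    · refine hν _ _ (Fin.lt_def.2 ?_)
      simp only
      omega
    · refine ⟨0, ?_⟩
      rw [Nat.cast_zero, sub_eq_zero]
      simp only [N]
      congr 2
      omega
  choose m hm using hN
  -- The twist is the last entry, and the leading minor of size `t + 1` has the drop from entry `t`
  -- to entry `t + 1` as exponent; the weight then telescopes.
  refine ⟨N (k - 1), ∏ t ∈ Finset.range (k - 1), minor (t + 1) id ^ m t,
    Finset.prod_ne_zero_iff.2 fun t _ => pow_ne_zero _ (minor_id_ne_zero _), ?_⟩
  convert isHighestPoly_prod (Finset.range (k - 1)) (fun t => m t • initialWeight k (t + 1)) _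
    (fun t _ => (isHighestPoly_minor (t + 1)).pow (m t)) using 1
  funext p
  have hp : (p : ℕ) ≤ k - 1 := by omega
  have h1 : ν p = N p := by
    simp only [N]
    congr 1
    exact Fin.ext (by simp [hp])
  rw [h1, Finset.sum_apply]
  have h2 : ∀ t, (m t • initialWeight k (t + 1)) p =
      if (p : ℕ) ≤ t then N t - N (t + 1) else 0 := by
    intro t
    rw [hm, Pi.smul_apply, initialWeight, nsmul_eq_mul]
    simp only [Nat.lt_succ_iff]
    split_ifs <;> simp
  simp only [h2]
  generalize k - 1 = n at hp
  induction n, hp using Nat.le_induction with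
  | base =>
    rw [sub_self, Finset.sum_eq_zero]
    exact fun t ht => if_neg (Finset.mem_range.1 ht).not_ge
  | succ n hn ih =>
    rw [Finset.sum_range_succ, ← ih, if_pos hn]
    ring

lemma IsDominantIntegral.of_nonneg {lam ν : Fin k → ℝ} (h : IsDominantIntegral lam)
    (δ : Fin k → ℤ) (hν : ∀ a, ν a = lam a - δ a) (hle : ∀ a b, a < b → ν b ≤ ν a) :
    IsDominantIntegral ν := by
  intro a b hab
  obtain ⟨n, hn⟩ := h a b hab
  have h1 : ν a - ν b = ((n - δ a + δ b : ℤ) : ℝ) := by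
    rw [hν, hν]
    push_cast
    linarith
  have h2 : (0 : ℤ) ≤ n - δ a + δ b := by
    have := sub_nonneg.2 (hle a b hab)
    rw [h1] at this
    exact_mod_cast this
  obtain ⟨q, hq⟩ := Int.eq_ofNat_of_zero_le h2
  exact ⟨q, by rw [h1, hq]; rfl⟩

lemma IsDominantIntegral.le {lam : Fin k → ℝ} (h : IsDominantIntegral lam) {a b : Fin k}
    (hab : a ≤ b) : lam b ≤ lam a := by
  rcases hab.eq_or_lt with rfl | hab
  · exact le_rfl
  · obtain ⟨n, hn⟩ := h a b hab
    have : (0 : ℝ) ≤ n := n.cast_nonneg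
    linarith

variable {lam : Fin k → ℝ} {i j : Fin k}

lemma sum_addPair (x : gl k) : ((∑ a, addPair lam i j a * x a a : ℝ) : ℂ) =
    ((∑ a, lam a * x a a : ℝ) : ℂ) + x i i + x j j := by
  simp only [addPair, Pi.add_apply, add_mul, Finset.sum_add_distrib, Pi.single_apply, ite_mul,
    one_mul, zero_mul, Finset.sum_ite_eq', Finset.mem_univ, if_true, Complex.ofReal_add]

/-- Dominance of `λ + εᵢ + εⱼ` forces a strict drop from an entry that is not raised to a later one
that is. -/
lemma lt_of_addPair (hij : i < j)
    (h' : IsDominantIntegral (addPair lam i j)) {a b : Fin k} (hab : a < b)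
    (ha : a ≠ i) (ha' : a ≠ j) (hb : b = i ∨ b = j) : lam b + 1 ≤ lam a := by
  have h1 := h'.le hab.le
  rcases hb with rfl | rfl
  · simpa [addPair, ha, ha', hij.ne] using h1
  · simpa [addPair, ha, ha', hij.ne'] using h1

lemma isDominantIntegral_sub_initialWeight (hij : i < j) (h : IsDominantIntegral lam)
    (h' : IsDominantIntegral (addPair lam i j)) :
    IsDominantIntegral (fun a => lam a - initialWeight k i a) := by
  refine h.of_nonneg (fun a => if a < i then 1 else 0) (fun a => ?_) fun a b hab => ?_
  · simp only [initialWeight, Fin.lt_def]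
    split_ifs <;> simp
  · simp only [initialWeight, ← Fin.lt_def]
    by_cases ha : a < i
    · by_cases hb : b < i
      · simpa [ha, hb] using h.le hab.le
      · have h1 := lt_of_addPair hij h' ha ha.ne (ha.trans hij).ne (Or.inl rfl)
        have h2 := h.le (not_lt.1 hb)
        simp only [ha, hb, if_true, if_false]
        linarith
    · have hb : ¬ b < i := fun hb => ha (hab.trans hb)
      simpa [ha, hb] using h.le hab.le

lemma isDominantIntegral_sub_initialWeight₂ (hij : (i : ℕ) + 1 < j) (h : IsDominantIntegral lam)
    (h' : IsDominantIntegral (addPair lam i j)) :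
    IsDominantIntegral (fun a => lam a - initialWeight k i a - initialWeight k j a) := by
  have hlt : i < j := Fin.lt_def.2 (by omega)
  have hstep : ∀ a, a < j → lam j + 1 ≤ lam a := by
    intro a ha
    -- The unraised index `i + 1` lies strictly between `i` and `j`, which gives a drop before `j`.
    -- This fails for adjacent indices, where `λᵢ = λⱼ` is possible.
    have hm : (⟨i + 1, by omega⟩ : Fin k) < j := hij
    have h1 := lt_of_addPair hlt h' hm (fun h => by simp [Fin.ext_iff] at h) hm.ne (Or.inr rfl)
    by_cases hai : a ≤ i
    · exact h1.trans (h.le (hai.trans (Fin.le_def.2 (Nat.le_succ _))))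
    · exact lt_of_addPair hlt h' ha (fun h => hai h.le) ha.ne (Or.inr rfl)
  have h0 := isDominantIntegral_sub_initialWeight hlt h h'
  refine h0.of_nonneg (fun a => if a < j then 1 else 0) (fun a => ?_) fun a b hab => ?_
  · simp only [initialWeight, Fin.lt_def]
    split_ifs <;> simp
  · have h3 := h0.le hab.le
    simp only [initialWeight, ← Fin.lt_def] at h3 ⊢
    by_cases ha : a < j
    · by_cases hb : b < j
      · simp only [ha, hb, if_true]
        linarith
      · have hb' : ¬ b < i := fun h => hb (h.trans hlt)
        have h1 := h.le (not_lt.1 hb)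
        simp only [ha, hb, hb', if_true, if_false]
        by_cases hai : a < i
        · have h2 := lt_of_addPair hlt h' hai hai.ne (hai.trans hlt).ne (Or.inl rfl)
          have h4 := hstep i hlt
          simp only [hai, if_true]
          linarith
        · have h4 := hstep a ha
          simp only [hai, if_false]
          linarith
    · have hb : ¬ b < j := fun hb => ha (hab.trans hb)
      simp only [ha, hb, if_false]
      linarith

/-- The coefficients of a highest weight vector of weight `λ + εᵢ + εⱼ` in the tensor product of
the exterior square of `ℂᵏ` and the twisted polynomial representation. -/
lemma exists_coefficients (hij : i < j) (h : IsDominantIntegral lam)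
    (h' : IsDominantIntegral (addPair lam i j)) :
    ∃ (c : ℝ) (w₀ : MatPoly k) (g : Fin k → Fin k → MatPoly k) (s : ℂ),
      w₀ ≠ 0 ∧ IsHighestWeightVector (polyRep k c) lam w₀ ∧ s ≠ 0 ∧ g i j - g j i = s • w₀ ∧
      (∀ x : gl k, (∀ a b : Fin k, b ≤ a → x a b = 0) → ∀ b d, polyRep k c x (g b d) =
        -∑ e, ((x b e : ℂ) • g e d + (x d e : ℂ) • g b e)) ∧
      (∀ x : gl k, x.IsDiag → ∀ b d, polyRep k c x (g b d) =
        (((∑ a, addPair lam i j a * x a a : ℝ) : ℂ) - x b b - x d d) • g b d) := by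
  by_cases hcase : (i : ℕ) + 1 < j
  -- With a gap, the vector is `f` times the wedge of the two polarised minor vectors. In `g i j - g
  -- j i` the second term has the vanishing factor `polarMinor i j`.
  · obtain ⟨c, f, hf0, hf⟩ := (isDominantIntegral_sub_initialWeight₂ hcase h h').exists_poly
    have hw := (hf.mul (isHighestPoly_minor (k := k) i)).mul (isHighestPoly_minor (k := k) j)
    refine ⟨c, f * minor i id * minor j id, fun b d => f * polarMinor i b * polarMinor j d, 1,
      mul_ne_zero (mul_ne_zero hf0 (minor_id_ne_zero _)) (minor_id_ne_zero _), ?_, one_ne_zero, ?_,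
      ?_, ?_⟩
    · convert hw.isHighestWeightVector c using 1
      funext a
      simp only [Pi.add_apply]
      ring
    · beta_reduce
      rw [polarMinor_self, polarMinor_self, polarMinor_of_gt hij, mul_zero, zero_mul, sub_zero,
        one_smul]
    · intro x hx b d
      rw [polyRep_apply, trace_eq_zero_of_upper hx, mul_zero, Complex.ofReal_zero, zero_smul,
        add_zero, Derivation.leibniz, Derivation.leibniz, hf.upper x hx,
        polyDer_polarMinor_of_upper hx, polyDer_polarMinor_of_upper hx, Finset.sum_add_distrib]
      simp only [smul_eq_mul, mul_zero, add_zero, mul_neg, Finset.mul_sum, mul_smul_comm,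
        neg_add]
      rw [add_comm]
      congr 3
      funext e
      rw [mul_comm]
    · intro x hx b d
      have hfd := hf.diag x hx
      have e1 : (∑ a, lam a * x a a) = (∑ a, (lam a - initialWeight k i a - initialWeight k j a - c)
          * x a a) + c * x.trace + diagSum i x + diagSum j x := by
        rw [← sum_initialWeight, ← sum_initialWeight, Matrix.trace, Finset.mul_sum,
          ← Finset.sum_add_distrib, ← Finset.sum_add_distrib, ← Finset.sum_add_distrib]
        refine Finset.sum_congr rfl fun a _ => ?_
        rw [Matrix.diag_apply]
        ring
      rw [polyRep_apply, Derivation.leibniz, Derivation.leibniz, hfd,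
        polyDer_polarMinor_of_isDiag hx, polyDer_polarMinor_of_isDiag hx, sum_addPair, e1]
      simp only [smul_eq_C_mul, smul_eq_mul, Complex.ofReal_add, map_add, map_sub]
      ring
  · have hj : (j : ℕ) = i + 1 := by
      have := Fin.lt_def.1 hij
      omega
    obtain ⟨c, f, hf0, hf⟩ := (isDominantIntegral_sub_initialWeight hij h h').exists_poly
    have hw := hf.mul (isHighestPoly_minor (k := k) i)
    -- The coefficients are already antisymmetric, so antisymmetrising doubles them: hence the
    -- scalar `2`.
    refine ⟨c, f * minor i id, fun b d => f * polarMinor₂ i j b d, 2,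
      mul_ne_zero hf0 (minor_id_ne_zero _), ?_, two_ne_zero, ?_, ?_, ?_⟩
    · convert hw.isHighestWeightVector c using 1
      funext a
      simp only [Pi.add_apply]
      ring
    · beta_reduce
      rw [polarMinor₂_swap hij i j, polarMinor₂_self hij, two_smul]
      ring
    · intro x hx b d
      rw [polyRep_apply, trace_eq_zero_of_upper hx, mul_zero, Complex.ofReal_zero, zero_smul,
        add_zero, Derivation.leibniz, hf.upper x hx, polyDer_polarMinor₂_of_upper hx hj]
      simp only [smul_eq_mul, mul_zero, add_zero, mul_neg, Finset.mul_sum, mul_add, mul_smul_comm]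
    · intro x hx b d
      have hfd := hf.diag x hx
      have e1 : (∑ a, lam a * x a a) = (∑ a, (lam a - initialWeight k i a - c)
          * x a a) + c * x.trace + diagSum i x := by
        rw [← sum_initialWeight, Matrix.trace, Finset.mul_sum,
          ← Finset.sum_add_distrib, ← Finset.sum_add_distrib]
        refine Finset.sum_congr rfl fun a _ => ?_
        rw [Matrix.diag_apply]
        ring
      rw [polyRep_apply, Derivation.leibniz, hfd, polyDer_polarMinor₂_of_isDiag hx hij, sum_addPair, e1]
      simp only [smul_eq_C_mul, smul_eq_mul, Complex.ofReal_add, map_add, map_sub]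
      ring

end PolyHighestWeight

/-! ### Plücker coordinates on the exterior square. -/

section Wedge

variable {k : ℕ}

/-- The Plücker coordinate `u ∧ v ↦ u b * v c - u c * v b`. -/
noncomputable def plucker (b c : Fin k) : (⋀[ℂ]^2 (Fin k → ℂ)) →ₗ[ℂ] ℂ :=
  exteriorPower.alternatingMapLinearEquiv
    ((Matrix.detRowAlternating (n := Fin 2) (R := ℂ)).compLinearMap (LinearMap.funLeft ℂ ℂ ![b, c]))

lemma plucker_wedge (b c : Fin k) (u v : Fin k → ℂ) :
    plucker b c (exteriorPower.ιMulti ℂ 2 ![u, v]) = u b * v c - u c * v b := by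
  rw [plucker, exteriorPower.alternatingMapLinearEquiv_apply_ιMulti,
    AlternatingMap.compLinearMap_apply]
  refine (Matrix.det_fin_two _).trans ?_
  simp [LinearMap.funLeft_apply]

lemma extSquare_hom_ext {V N : Type*} [AddCommGroup V] [Module ℂ V] [AddCommGroup N] [Module ℂ N]
    {f g : (⋀[ℂ]^2 V) →ₗ[ℂ] N}
    (h : ∀ u v : V, f (exteriorPower.ιMulti ℂ 2 ![u, v]) = g (exteriorPower.ιMulti ℂ 2 ![u, v])) :
    f = g := by
  apply exteriorPower.linearMap_ext
  ext1 v
  have hv : v = ![v 0, v 1] := by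
    funext a
    fin_cases a <;> rfl
  have h2 := h (v 0) (v 1)
  rw [← hv] at h2
  exact h2

lemma plucker_swap (b c : Fin k) : plucker c b = -plucker b c := by
  refine extSquare_hom_ext fun u v => ?_
  rw [LinearMap.neg_apply, plucker_wedge, plucker_wedge]
  ring

lemma defGL_apply (x : gl k) (v : Fin k → ℂ) (a : Fin k) :
    defGL k x v a = ∑ d, (x a d : ℂ) * v d := rfl

lemma plucker_extSquare (x : gl k) (b c : Fin k) (ω : ⋀[ℂ]^2 (Fin k → ℂ)) :
    plucker b c (extSquare (defGL k) x ω) =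
      ∑ d, ((x b d : ℂ) * plucker d c ω + (x c d : ℂ) * plucker b d ω) := by
  have h : plucker b c ∘ₗ extSquare (defGL k) x =
      ∑ d, ((x b d : ℂ) • plucker d c + (x c d : ℂ) • plucker b d) := by
    refine extSquare_hom_ext fun u v => ?_
    have h1 : extSquare (defGL k) x (exteriorPower.ιMulti ℂ 2 ![u, v]) = _ :=
      wedgeDeriv_wedge (defGL k x) u v
    rw [LinearMap.comp_apply, h1, map_add]
    simp only [LinearMap.sum_apply, LinearMap.add_apply, LinearMap.smul_apply, plucker_wedge,
      defGL_apply, smul_eq_mul, Finset.sum_mul, Finset.mul_sum, ← Finset.sum_sub_distrib,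
      ← Finset.sum_add_distrib]
    refine Finset.sum_congr rfl fun d _ => ?_
    ring
  have := LinearMap.congr_fun h ω
  simpa [LinearMap.sum_apply] using this

/-- The wedge product of two vectors as a bilinear map. -/
noncomputable def wedge (V : Type*) [AddCommGroup V] [Module ℂ V] :
    V →ₗ[ℂ] V →ₗ[ℂ] ⋀[ℂ]^2 V :=
  LinearMap.mk₂ ℂ (fun u v => exteriorPower.ιMulti ℂ 2 ![u, v]) wedge_add_left wedge_smul_left
    (fun u v w => wedge_add_right v w u) (fun c u v => wedge_smul_right c v u)

lemma wedge_eq_sum (u v : Fin k → ℂ) : exteriorPower.ιMulti ℂ 2 ![u, v] =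
    ∑ b, ∑ c, (u b * v c) • wedge (Fin k → ℂ) (Pi.single b 1) (Pi.single c 1) := by
  change wedge (Fin k → ℂ) u v = _
  conv_lhs => rw [pi_eq_sum_univ' u, pi_eq_sum_univ' v]
  simp only [map_sum, map_smul, LinearMap.sum_apply, LinearMap.smul_apply, Finset.smul_sum,
    smul_smul]
  rw [Finset.sum_comm]
  simp only [mul_comm]

/-- Summing over ordered pairs counts each basis bivector twice, which avoids choosing an ordered
basis. -/
lemma two_smul_eq_sum_plucker (ω : ⋀[ℂ]^2 (Fin k → ℂ)) : (2 : ℂ) • ω =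
    ∑ b, ∑ c, plucker b c ω • wedge (Fin k → ℂ) (Pi.single b 1) (Pi.single c 1) := by
  have h : (2 : ℂ) • LinearMap.id = ∑ b, ∑ c, (plucker b c).smulRight
      (wedge (Fin k → ℂ) (Pi.single b 1) (Pi.single c 1)) := by
    refine extSquare_hom_ext fun u v => ?_
    simp only [LinearMap.smul_apply, LinearMap.id_apply, LinearMap.sum_apply,
      LinearMap.smulRight_apply, plucker_wedge, sub_smul, Finset.sum_sub_distrib]
    have h2 : ∑ b, ∑ c, (u c * v b) • wedge (Fin k → ℂ) (Pi.single b 1) (Pi.single c 1) =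
        exteriorPower.ιMulti ℂ 2 ![v, u] := by
      rw [wedge_eq_sum]
      exact Finset.sum_congr rfl fun b _ => Finset.sum_congr rfl fun c _ => by rw [mul_comm]
    rw [h2, ← wedge_eq_sum, two_smul, eq_sub_iff_add_eq, add_assoc, wedge_swap_add, add_zero]
  have := LinearMap.congr_fun h ω
  simpa [LinearMap.sum_apply] using this

end Wedge

/-! ### Components and the inner product on the tensor product. -/

section Component

variable {k : ℕ} {W : Type*} [AddCommGroup W] [Module ℂ W]

/-- The Plücker coordinates of an element of the tensor product of the exterior square of `ℂᵏ`
and `W`. -/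
noncomputable def component (b c : Fin k) : (⋀[ℂ]^2 (Fin k → ℂ)) ⊗[ℂ] W →ₗ[ℂ] W :=
  TensorProduct.lift (LinearMap.lsmul ℂ W ∘ₗ plucker b c)

lemma component_tmul (b c : Fin k) (ω : ⋀[ℂ]^2 (Fin k → ℂ)) (w : W) :
    component b c (ω ⊗ₜ[ℂ] w) = plucker b c ω • w := rfl

lemma component_swap (b c : Fin k) (t : (⋀[ℂ]^2 (Fin k → ℂ)) ⊗[ℂ] W) :
    component c b t = -component b c t := by
  induction t with
  | zero => simp
  | tmul ω w => rw [component_tmul, component_tmul, plucker_swap, LinearMap.neg_apply, neg_smul]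
  | add s t hs ht => rw [map_add, map_add, hs, ht, neg_add]

lemma component_tensorRep (R : CRep (gl k) W) (x : gl k) (b c : Fin k)
    (t : (⋀[ℂ]^2 (Fin k → ℂ)) ⊗[ℂ] W) :
    component b c (tensorRep (extSquare (defGL k)) R x t) =
      ∑ d, ((x b d : ℂ) • component d c t + (x c d : ℂ) • component b d t)
        + R x (component b c t) := by
  induction t with
  | zero => simp
  | tmul ω w =>
    change component b c (extSquare (defGL k) x ω ⊗ₜ[ℂ] w + ω ⊗ₜ[ℂ] R x w) = _
    rw [map_add]
    simp only [component_tmul, plucker_extSquare, Finset.sum_smul, add_smul, map_smul, mul_smul]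
  | add s t hs ht =>
    simp only [map_add, hs, ht, smul_add, Finset.sum_add_distrib]
    abel

lemma eq_zero_of_component {t : (⋀[ℂ]^2 (Fin k → ℂ)) ⊗[ℂ] W}
    (h : ∀ b c : Fin k, component b c t = 0) : t = 0 := by
  have h1 : (2 : ℂ) • t = ∑ b, ∑ c,
      wedge (Fin k → ℂ) (Pi.single b 1) (Pi.single c 1) ⊗ₜ[ℂ] component b c t := by
    clear h
    induction t with
    | zero => simp
    | tmul ω w =>
      rw [TensorProduct.smul_tmul', two_smul_eq_sum_plucker]
      simp only [TensorProduct.sum_tmul, component_tmul, TensorProduct.smul_tmul]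
    | add s t hs ht =>
      simp only [smul_add, hs, ht, map_add, TensorProduct.tmul_add, Finset.sum_add_distrib]
  simp only [h, TensorProduct.tmul_zero, Finset.sum_const_zero] at h1
  exact (smul_eq_zero.1 h1).resolve_left two_ne_zero

lemma component_wedge_tmul (b c p q : Fin k) (w : W) :
    component b c (wedge (Fin k → ℂ) (Pi.single p 1) (Pi.single q 1) ⊗ₜ[ℂ] w) =
      ((if b = p ∧ c = q then w else 0) - if c = p ∧ b = q then w else 0) := by
  have h : plucker b c (wedge (Fin k → ℂ) (Pi.single p 1) (Pi.single q 1)) = _ :=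
    plucker_wedge b c _ _
  rw [component_tmul, h, sub_smul]
  simp only [Pi.single_apply]
  congr 1 <;> split_ifs <;> simp_all

/-- A positive definite contravariant form on `W` induces one on the tensor product of the exterior
square of `ℂᵏ` and `W`. -/
lemma IsContravariant.extSquare_tensor {R : CRep (gl k) W} {B : W → W →ₗ[ℂ] ℂ}
    (hB : IsContravariant R B) : IsContravariant (tensorRep (extSquare (defGL k)) R)
      (fun s => ∑ b, ∑ c, B (component b c s) ∘ₗ component b c) where
  conj_symm s t := by
    simp only [LinearMap.sum_apply, LinearMap.comp_apply, map_sum, hB.conj_symm]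
  re_pos s hs := by
    simp only [LinearMap.sum_apply, LinearMap.comp_apply, Complex.re_sum]
    have hnn : ∀ w, 0 ≤ (B w w).re := fun w => by
      by_cases hw : w = 0
      · simp [hw]
      · exact (hB.re_pos w hw).le
    have hex : ∃ b c : Fin k, component b c s ≠ 0 := by
      by_contra! h
      exact hs (eq_zero_of_component h)
    obtain ⟨b, c, hbc⟩ := hex
    exact Finset.sum_pos' (fun _ _ => Finset.sum_nonneg fun _ _ => hnn _) ⟨b, Finset.mem_univ b,
      Finset.sum_pos' (fun _ _ => hnn _) ⟨c, Finset.mem_univ c, hB.re_pos _ hbc⟩⟩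
  apply_left x s t := by
    have hsum : ∀ (f : Fin k → W) (w : W), B (∑ d, f d) w = ∑ d, B (f d) w := by
      intro f w
      rw [← hB.conj_symm, map_sum, map_sum]
      simp only [hB.conj_symm]
    simp only [LinearMap.sum_apply, LinearMap.comp_apply, component_tensorRep, map_add, map_sum,
      hB.add_left, hsum, hB.smul_left, map_smul, smul_eq_mul, Complex.conj_ofReal, hB.apply_left,
      Finset.sum_add_distrib, Matrix.transpose_apply]
    congr 2
    · rw [Finset.sum_comm]
      refine Eq.trans ?_ Finset.sum_comm
      exact Finset.sum_congr rfl fun c _ => Finset.sum_comm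
    · exact Finset.sum_congr rfl fun b _ => Finset.sum_comm

end Component

/-! ### Highest weight vectors in the tensor product. -/

section TensorHighestWeight

variable {k : ℕ} {W : Type*} [AddCommGroup W] [Module ℂ W] {lam : Fin k → ℝ} {i j : Fin k}

lemma sum_component_of_isDiag {x : gl k} (hx : x.IsDiag) (b c : Fin k)
    (t : (⋀[ℂ]^2 (Fin k → ℂ)) ⊗[ℂ] W) :
    ∑ d, ((x b d : ℂ) • component d c t + (x c d : ℂ) • component b d t) =
      ((x b b : ℂ) + x c c) • component b c t := by
  rw [Finset.sum_add_distrib, Finset.sum_eq_single b, Finset.sum_eq_single c, add_smul]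
  · intro d _ hd
    rw [hx hd.symm, Complex.ofReal_zero, zero_smul]
  · simp
  · intro d _ hd
    rw [hx hd.symm, Complex.ofReal_zero, zero_smul]
  · simp

/-- A highest weight vector of weight `λ + εᵢ + εⱼ` vanishes when its component in the direction of
`eᵢ ∧ eⱼ` is orthogonal to the highest weight vector of `W`. -/
lemma IsContravariant.eq_zero_of_component {R : CRep (gl k) W} {B : W → W →ₗ[ℂ] ℂ}
    (hB : IsContravariant R B) (hR : IsIrreducible R) {w : W}
    (hw : IsHighestWeightVector R lam w) (hw0 : w ≠ 0) (hij : i < j)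
    {t : (⋀[ℂ]^2 (Fin k → ℂ)) ⊗[ℂ] W}
    (ht : IsHighestWeightVector (tensorRep (extSquare (defGL k)) R) (addPair lam i j) t)
    (h0 : B w (component i j t) = 0) : t = 0 := by
  have h1 : ∀ b c : Fin k, B w (component b c t) = 0 := by
    intro b c
    by_contra hne
    -- The component along `e_b ∧ e_c` has weight `λ + εᵢ + εⱼ - ε_b - ε_c`. A nonzero pairing with
    -- `w` makes this equal to `λ`, since diagonal matrices are self-adjoint.
    have hdiag : ∀ x : gl k, x.IsDiag → x i i + x j j = x b b + x c c := by
      intro x hx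
      have e1 := component_tensorRep R x b c t
      rw [ht.diag x hx, sum_component_of_isDiag hx, map_smul] at e1
      have e2 := hB.apply_left x w (component b c t)
      have hxt : x.transpose = x := hx.isSymm
      rw [hw.diag x hx, hB.smul_left, Complex.conj_ofReal, hxt] at e2
      have e3 := congrArg (B w) e1
      rw [map_smul, map_add, map_smul, ← e2, smul_eq_mul, smul_eq_mul, ← add_mul] at e3
      have e4 := mul_right_cancel₀ hne e3
      rw [sum_addPair] at e4
      have e5 : (x i i : ℂ) + x j j = x b b + x c c := by linear_combination e4
      exact_mod_cast e5
    have hi := hdiag (Matrix.diagonal (Pi.single i 1)) (Matrix.isDiag_diagonal _)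
    have hj := hdiag (Matrix.diagonal (Pi.single j 1)) (Matrix.isDiag_diagonal _)
    simp only [Matrix.diagonal_apply_eq, Pi.single_apply, hij.ne, hij.ne', if_true, if_false]
      at hi hj
    have hcases : (b = i ∧ c = j) ∨ (b = j ∧ c = i) := by
      by_cases hbi : b = i
      · have hbj : ¬ b = j := fun h => hij.ne (hbi.symm.trans h)
        refine Or.inl ⟨hbi, ?_⟩
        by_contra hcj
        rw [if_neg hbj, if_neg hcj] at hj
        norm_num at hj
      · have hci : c = i := by
          by_contra hci
          rw [if_neg hbi, if_neg hci] at hi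
          norm_num at hi
        have hcj : ¬ c = j := fun h => hij.ne (hci.symm.trans h)
        refine Or.inr ⟨?_, hci⟩
        by_contra hbj
        rw [if_neg hbj, if_neg hcj] at hj
        norm_num at hj
    rcases hcases with ⟨rfl, rfl⟩ | ⟨rfl, rfl⟩
    · exact hne h0
    · rw [component_swap, map_neg, h0, neg_zero] at hne
      exact hne rfl
  let p : Submodule ℂ W :=
    { carrier := {φ | ∀ b c : Fin k, B φ (component b c t) = 0}
      add_mem' := fun ha hb b c => by rw [hB.add_left, ha b c, hb b c, add_zero]
      zero_mem' := fun b c => hB.zero_left _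
      smul_mem' := fun r φ h b c => by rw [hB.smul_left, h b c, mul_zero] }
  have hp : p = ⊤ := by
    refine hw.eq_top hR hw0 (p := p) h1 ?_
    intro a b hab φ hφ c d
    -- The transpose is a raising operator and kills `t`. Hence raising one component gives a
    -- combination of the other components, all of which are orthogonal to `φ`.
    have e1 := component_tensorRep R (Matrix.single b a 1).transpose c d t
    rw [ht.upper _ (fun r s hsr => by
      rw [Matrix.transpose_single, Matrix.single_apply, if_neg]
      rintro ⟨rfl, rfl⟩
      exact absurd hab hsr.not_gt), map_zero] at e1
    have e2 := congrArg (B φ) e1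
    rw [map_zero, map_add, map_sum, Finset.sum_eq_zero, zero_add] at e2
    · rw [hB.apply_left, ← e2]
    · intro e _
      rw [map_add, map_smul, map_smul, hφ e d, hφ c e, smul_zero, smul_zero, add_zero]
  refine GLRep.eq_zero_of_component fun b c => ?_
  by_contra h
  exact hB.self_ne_zero h ((hp ▸ Submodule.mem_top : component b c t ∈ p) b c)

/-- The hypotheses on `g` say that it transforms dually to the wedges `e_b ∧ e_d`, so contracting
the two gives a highest weight vector. An equivariant `π` preserves these relations. -/
lemma exists_highestWeightVector {R : CRep (gl k) W} {c : ℝ}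
    {π : MatPoly k →ₗ[ℂ] W} (hπ : Intertwines (polyRep k c) R π)
    {g : Fin k → Fin k → MatPoly k}
    (hg : ∀ x : gl k, (∀ a b : Fin k, b ≤ a → x a b = 0) → ∀ b d, polyRep k c x (g b d) =
        -∑ e, ((x b e : ℂ) • g e d + (x d e : ℂ) • g b e))
    (hg' : ∀ x : gl k, x.IsDiag → ∀ b d, polyRep k c x (g b d) =
        (((∑ a, addPair lam i j a * x a a : ℝ) : ℂ) - x b b - x d d) • g b d) :
    ∃ t : (⋀[ℂ]^2 (Fin k → ℂ)) ⊗[ℂ] W,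
      IsHighestWeightVector (tensorRep (extSquare (defGL k)) R) (addPair lam i j) t ∧
      component i j t = π (g i j - g j i) := by
  let t : (⋀[ℂ]^2 (Fin k → ℂ)) ⊗[ℂ] W :=
    ∑ b, ∑ d, wedge (Fin k → ℂ) (Pi.single b 1) (Pi.single d 1) ⊗ₜ[ℂ] π (g b d)
  have hcomp : ∀ b d, component b d t = π (g b d - g d b) := by
    intro b d
    simp only [t, map_sum, component_wedge_tmul, Finset.sum_sub_distrib, ite_and]
    simp [map_sub]
  have hπ' : ∀ (x : gl k) (f : MatPoly k), R x (π f) = π (polyRep k c x f) :=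
    fun x f => (hπ x f).symm
  refine ⟨t, ⟨fun x hx => ?_, fun x hx => ?_⟩, hcomp i j⟩
  · rw [← sub_eq_zero]
    refine eq_zero_of_component fun b d => ?_
    rw [map_sub, component_tensorRep, sum_component_of_isDiag hx, map_smul, hcomp, hπ',
      map_sub (polyRep k c x), hg' x hx, hg' x hx, map_sub, map_sub, map_smul, map_smul]
    module
  · refine eq_zero_of_component fun b d => ?_
    rw [component_tensorRep]
    simp only [hcomp, hπ', map_sub, hg x hx, map_neg, map_sum, map_add, map_smul, smul_sub,
      Finset.sum_add_distrib, Finset.sum_sub_distrib]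
    abel

end TensorHighestWeight

/-! ### Multiplicity one over `gl`. -/

section Multiplicity

variable {k : ℕ} {W : Type*} [AddCommGroup W] [Module ℂ W] [FiniteDimensional ℂ W]
  {U : Type*} [AddCommGroup U] [Module ℂ U] [FiniteDimensional ℂ U]

/-- The multiplicity statement for representations of `𝔤𝔩(k, ℝ)`. -/
lemma hasMultiplicity_one_gl {lam : Fin k → ℝ} {i j : Fin k} (hij : i < j)
    (hlam : IsDominantIntegral lam) (hlamij : IsDominantIntegral (addPair lam i j))
    {R : CRep (gl k) W} (hR : IsIrreducible R) {w : W} (hw : IsHighestWeightVector R lam w)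
    (hw0 : w ≠ 0) {S : CRep (gl k) U} (hS : IsIrreducible S) {u : U}
    (hu : IsHighestWeightVector S (addPair lam i j) u) (hu0 : u ≠ 0) :
    HasMultiplicity S (tensorRep (extSquare (defGL k)) R) 1 := by
  obtain ⟨c, w₀, g, s, hw₀0, hw₀, hs, hgs, hg, hg'⟩ := exists_coefficients hij hlam hlamij
  obtain ⟨φ, hφ, hφinj, hφw⟩ := (isContravariant_fischer c).exists_embedding hR hw hw0 hw₀ hw₀0
  obtain ⟨π, hπ, hπφ⟩ := (isContravariant_fischer c).exists_leftInverse hφ hφinj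
  have hB := (isContravariant_fischer c).comp hφ hφinj
  obtain ⟨t, ht, htc⟩ := exists_highestWeightVector hπ hg hg'
  have ht0 : t ≠ 0 := by
    rintro rfl
    rw [map_zero, hgs, map_smul, ← hφw, hπφ] at htc
    exact (smul_ne_zero hs hw0) htc.symm
  have hBT := hB.extSquare_tensor
  obtain ⟨f, hf, hfinj, hfu⟩ := hBT.exists_embedding hS hu hu0 ht ht0
  have hinv : IsInvariant (tensorRep (extSquare (defGL k)) R) (LinearMap.range f) := by
    rintro x _ ⟨m, rfl⟩
    exact ⟨S x m, hf x m⟩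
  obtain ⟨C, hC, hcompl⟩ := hBT.exists_isCompl hinv
  have hrange : LinearMap.range (f ∘ₗ LinearMap.proj (R := ℂ) (φ := fun _ : Fin 1 => U) 0) =
      LinearMap.range f := LinearMap.range_comp_of_range_eq_top f (LinearMap.range_eq_top.2
        (LinearMap.proj_surjective 0))
  refine ⟨f ∘ₗ LinearMap.proj 0, C, fun x v => hf x (v 0), fun v v' hv => ?_, hC, ?_, ?_⟩
  · funext a
    rw [Subsingleton.elim a 0]
    exact hfinj hv
  · rw [hrange]
    exact hcompl
  · rintro ⟨f', hf', hf'inj, hf'C⟩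
    have ht' := hf'.isHighestWeightVector hu
    have hne := mt (hB.eq_zero_of_component hR hw hw0 hij ht) ht0
    set B : W → W →ₗ[ℂ] ℂ := fun v => fischer (φ v) ∘ₗ φ
    -- This combination of `f' u` and `t` is chosen so that its pairing with `w` cancels. It
    -- therefore vanishes, which puts `f' u` in both the range of `f` and `C`.
    have hz := hB.eq_zero_of_component hR hw hw0 hij
      ((ht'.smul (B w (component i j t))).sub (ht.smul (B w (component i j (f' u)))))
      (by
        simp only [map_sub, map_smul, smul_eq_mul]
        ring)
    have hmem : f' u ∈ LinearMap.range f := by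
      rw [sub_eq_zero] at hz
      have h1 : B w (component i j t) • f' u ∈ LinearMap.range f := by
        rw [hz, ← hfu]
        exact Submodule.smul_mem _ _ ⟨u, rfl⟩
      exact (Submodule.smul_mem_iff _ hne).1 h1
    have hzero := Submodule.disjoint_def.1 hcompl.disjoint _ hmem (hf'C ⟨u, rfl⟩)
    exact hu0 (hf'inj (hzero.trans f'.map_zero.symm))

end Multiplicity

/-! ### Passage between `sl` and `gl`. -/

section Extend

variable {k : ℕ} {W : Type*} [AddCommGroup W] [Module ℂ W] {U : Type*} [AddCommGroup U] [Module ℂ U]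

lemma traceFree_coe (x : sl k) : traceFree k x.1 = x := by
  have hx : Matrix.trace x.1 = 0 := x.2
  apply Subtype.ext
  change x.1 - (x.1.trace / k) • (1 : gl k) = x.1
  rw [hx, zero_div, zero_smul, sub_zero]

lemma traceFree_apply (x : gl k) : (traceFree k x).1 = x - (x.trace / k) • (1 : gl k) := rfl

lemma extendGL_apply (ρ : CRep (sl k) W) (c : ℝ) (x : gl k) (w : W) :
    extendGL ρ c x w = ρ (traceFree k x) w + (x.trace / k * c) • w := rfl

lemma extendGL_coe (ρ : CRep (sl k) W) (c : ℝ) (x : sl k) : extendGL ρ c x.1 = ρ x := by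
  have hx : Matrix.trace x.1 = 0 := x.2
  refine LinearMap.ext fun w => ?_
  rw [extendGL_apply, traceFree_coe, hx, zero_div, zero_mul, zero_smul, add_zero]

lemma isInvariant_extendGL_iff {ρ : CRep (sl k) W} {c : ℝ} {p : Submodule ℂ W} :
    IsInvariant (extendGL ρ c) p ↔ IsInvariant ρ p := by
  refine ⟨fun h x w hw => ?_, fun h x w hw => ?_⟩
  · rw [← extendGL_coe ρ c]
    exact h _ w hw
  · rw [extendGL_apply, ← Complex.coe_smul]
    exact add_mem (h _ w hw) (p.smul_mem _ hw)

lemma isIrreducible_extendGL {ρ : CRep (sl k) W} (hρ : IsIrreducible ρ) (c : ℝ) :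
    IsIrreducible (extendGL ρ c) :=
  ⟨hρ.1, fun p hp => hρ.2 p (isInvariant_extendGL_iff.1 hp)⟩

lemma intertwines_extendGL_iff {σ : CRep (sl k) U} {τ : CRep (sl k) W} {c : ℝ} {f : U →ₗ[ℂ] W} :
    Intertwines (extendGL σ c) (extendGL τ c) f ↔ Intertwines σ τ f := by
  refine ⟨fun h x u => ?_, fun h x u => ?_⟩
  · rw [← extendGL_coe σ c, ← extendGL_coe τ c]
    exact h _ u
  · rw [extendGL_apply, extendGL_apply, map_add, h, ← Complex.coe_smul, map_smul, Complex.coe_smul]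

lemma copies_extendGL (σ : CRep (sl k) U) (c : ℝ) (m : ℕ) :
    copies (extendGL σ c) m = extendGL (copies σ m) c := rfl

/-- When the identity acts by the same scalar `c` on both sides, invariant subspaces and
intertwining maps are the same for the two algebras. -/
lemma hasMultiplicity_extendGL_iff {σ : CRep (sl k) U} {τ : CRep (sl k) W} {c : ℝ} {m : ℕ} :
    HasMultiplicity (extendGL σ c) (extendGL τ c) m ↔ HasMultiplicity σ τ m := by
  simp only [HasMultiplicity, copies_extendGL, intertwines_extendGL_iff, isInvariant_extendGL_iff]

lemma HasHighestWeight.exists_vector {ρ : CRep (sl k) W} {lam : Fin k → ℝ}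
    (h : HasHighestWeight ρ lam) :
    ∃ w, w ≠ 0 ∧ IsHighestWeightVector (extendGL ρ (∑ a, lam a)) lam w := by
  obtain ⟨w, hw0, hd, hu⟩ := h
  refine ⟨w, hw0, fun x hx => ?_, fun x hx => ?_⟩
  · have hdiag : (traceFree k x).1.IsDiag := by
      intro a b hab
      rw [traceFree_apply, Matrix.sub_apply, hx hab, Matrix.smul_apply, Matrix.one_apply_ne hab,
        smul_zero, sub_zero]
    rw [extendGL_apply, hd _ hdiag, ← Complex.coe_smul, ← add_smul, ← Complex.ofReal_add]
    congr 2
    rw [Finset.mul_sum, ← Finset.sum_add_distrib]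
    refine Finset.sum_congr rfl fun a _ => ?_
    rw [traceFree_apply, Matrix.sub_apply, Matrix.smul_apply, Matrix.one_apply_eq, smul_eq_mul]
    ring
  · have ht := trace_eq_zero_of_upper hx
    rw [extendGL_apply, hu _ (fun a b hab => ?_), ht, zero_div, zero_mul, zero_smul, add_zero]
    rw [traceFree_apply, ht, zero_div, zero_smul, sub_zero, hx a b hab]

lemma defSL_traceFree (x : gl k) (v : Fin k → ℂ) :
    defGL k x v = defSL k (traceFree k x) v + ((x.trace / k : ℝ) : ℂ) • v := by
  funext a
  change _ = defGL k (traceFree k x).1 v a + _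
  rw [traceFree_apply, map_sub, map_smul, LinearMap.sub_apply, LinearMap.smul_apply]
  have h1 : defGL k 1 v = v := by
    funext b
    rw [defGL_apply, Finset.sum_eq_single b]
    · simp
    · intro d _ hd
      rw [Matrix.one_apply_ne hd.symm, Complex.ofReal_zero, zero_mul]
    · simp
  rw [h1, ← Complex.coe_smul, Pi.sub_apply, sub_add_cancel]

lemma extSquare_traceFree (x : gl k) (ω : ⋀[ℂ]^2 (Fin k → ℂ)) :
    extSquare (defGL k) x ω =
      extSquare (defSL k) (traceFree k x) ω + ((x.trace / k * 2 : ℝ) : ℂ) • ω := by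
  have h : extSquare (defGL k) x =
      extSquare (defSL k) (traceFree k x) + ((x.trace / k * 2 : ℝ) : ℂ) • LinearMap.id := by
    refine end_extSquare_ext fun u v => ?_
    have h1 : extSquare (defGL k) x (exteriorPower.ιMulti ℂ 2 ![u, v]) = _ :=
      wedgeDeriv_wedge (defGL k x) u v
    have h2 : extSquare (defSL k) (traceFree k x) (exteriorPower.ιMulti ℂ 2 ![u, v]) = _ :=
      wedgeDeriv_wedge (defSL k (traceFree k x)) u v
    rw [h1, LinearMap.add_apply, h2, defSL_traceFree, defSL_traceFree, wedge_add_left,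
      wedge_add_right, wedge_smul_left, wedge_smul_right, LinearMap.smul_apply, LinearMap.id_apply,
      Complex.ofReal_mul, Complex.ofReal_ofNat]
    module
  exact LinearMap.congr_fun h ω

/-- The identity matrix acts on `Λ²ℂᵏ` by `2`. This is also the amount by which `addPair` raises the
sum of the entries, so the central scalars agree. -/
lemma tensorRep_extendGL (ρ : CRep (sl k) W) (c : ℝ) :
    tensorRep (extSquare (defGL k)) (extendGL ρ c) =
      extendGL (tensorRep (extSquare (defSL k)) ρ) (c + 2) := by
  refine DFunLike.ext _ _ fun x => TensorProduct.ext' fun ω w => ?_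
  change extSquare (defGL k) x ω ⊗ₜ[ℂ] w + ω ⊗ₜ[ℂ] extendGL ρ c x w =
    (extSquare (defSL k) (traceFree k x) ω ⊗ₜ[ℂ] w + ω ⊗ₜ[ℂ] ρ (traceFree k x) w) +
      ((x.trace / k * (c + 2) : ℝ) : ℂ) • (ω ⊗ₜ[ℂ] w)
  rw [extSquare_traceFree, extendGL_apply, TensorProduct.add_tmul, TensorProduct.tmul_add,
    ← Complex.coe_smul, TensorProduct.tmul_smul, ← TensorProduct.smul_tmul',
    mul_add, Complex.ofReal_add]
  module

lemma sum_addPair_entries (lam : Fin k → ℝ) (i j : Fin k) :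
    ∑ a, addPair lam i j a = ∑ a, lam a + 2 := by
  simp only [addPair, Pi.add_apply, Finset.sum_add_distrib, Finset.sum_pi_single', Finset.mem_univ,
    if_true]
  ring

end Extend

end GLRep

theorem mainTheorem6 {k : ℕ} (lam : Fin k → ℝ) (i j : Fin k) (hij : i < j)
    (hlam : GLRep.IsDominantIntegral lam)
    (hlamij : GLRep.IsDominantIntegral (GLRep.addPair lam i j))
    {W : Type*} [AddCommGroup W] [Module ℂ W] [FiniteDimensional ℂ W]
    (ρ : GLRep.CRep (GLRep.sl k) W) (hρ : GLRep.IsIrreducible ρ)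
    (hρlam : GLRep.HasHighestWeight ρ lam)
    {U : Type*} [AddCommGroup U] [Module ℂ U] [FiniteDimensional ℂ U]
    (σ : GLRep.CRep (GLRep.sl k) U) (hσ : GLRep.IsIrreducible σ)
    (hσlam : GLRep.HasHighestWeight σ (GLRep.addPair lam i j)) :
    GLRep.HasMultiplicity σ
        (GLRep.tensorRep (GLRep.extSquare (GLRep.defSL k)) ρ) 1 ∧
      GLRep.HasMultiplicity
        (GLRep.extendGL σ (∑ a, GLRep.addPair lam i j a))
        (GLRep.tensorRep (GLRep.extSquare (GLRep.defGL k)) (GLRep.extendGL ρ (∑ a, lam a))) 1 := by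
  obtain ⟨w, hw0, hw⟩ := hρlam.exists_vector
  obtain ⟨u, hu0, hu⟩ := hσlam.exists_vector
  have h := GLRep.hasMultiplicity_one_gl hij hlam hlamij (GLRep.isIrreducible_extendGL hρ _) hw hw0
    (GLRep.isIrreducible_extendGL hσ _) hu hu0
  refine ⟨?_, h⟩
  rw [GLRep.tensorRep_extendGL, GLRep.sum_addPair_entries] at h
  exact GLRep.hasMultiplicity_extendGL_iff.1 h
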